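/- Let $U\subset\mathbb{R}$ be an open interval and let $\gamma\colon U\to S^2\subset\mathbb{R}^3$ be a $C^3$ curve on the unit sphere such that $\operatorname{span}\{\gamma(\theta),\dot\gamma(\theta),\ddot\gamma(\theta)\}=\mathbb{R}^3$ for every $\theta\in U$. For $\theta\in U$ let $\rho_\theta\colon\mathbb{R}^3\to\mathbb{R}$, $\rho_\theta(x)=\gamma(\theta)\cdot x$, be the orthogonal projection onto the line spanned by $\gamma(\theta)$ (identified with $\mathbb{R}$), and let $\pi_\theta$ be the orthogonal projection of $\mathbb{R}^3$ onto the plane $V_\theta=\gamma(\theta)^\perp$ (identified with $\mathbb{R}^2$). Let $B\subset\mathbb{R}^3$ be an analytic set, and let $\dim_{\mathrm H}$ denote Hausdorff dimension. (a) If $\dim_{\mathrm H}B\le 1/2$, then $\dim_{\mathrm H}\rho_\theta(B)=\dim_{\mathrm H}B$ for Lebesgue almost every $\theta\in U$. (b) If $\dim_{\mathrm H}B\le 1$, then $\dim_{\mathrm H}\pi_\theta(B)=\dim_{\mathrm H}B$ for Lebesgue almost every $\theta\in U$. -/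

import Mathlib

open MeasureTheory

/-- A non-degenerate curve: `U` is an open interval (possibly unbounded), `γ` maps `U` into the
unit sphere of Euclidean `ℝ³`, is of class `C³` on `U`, and for every `θ ∈ U` the vectors
`γ(θ)`, `γ'(θ)`, `γ''(θ)` span `ℝ³`. The values of `γ` outside the open set `U` play no role. -/
structure IsNonDegenerateCurve (U : Set ℝ) (γ : ℝ → EuclideanSpace ℝ (Fin 3)) : Prop where
  isOpen : IsOpen U
  ordConnected : U.OrdConnected
  norm_eq_one : ∀ θ ∈ U, ‖γ θ‖ = 1
  contDiffOn : ContDiffOn ℝ 3 γ U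
  span_eq_top : ∀ θ ∈ U, Submodule.span ℝ {γ θ, deriv γ θ, deriv (deriv γ) θ} = ⊤

/-- The projection `ρ_θ(x) = γ(θ) · x` onto the line spanned by `γ(θ)`, viewed as a map to `ℝ`. -/
noncomputable def lineProj (γ : ℝ → EuclideanSpace ℝ (Fin 3)) (θ : ℝ) :
    EuclideanSpace ℝ (Fin 3) → ℝ :=
  fun x => inner ℝ (γ θ) x

/-- The plane `V_θ`, the orthogonal complement of the line spanned by `γ(θ)`. -/
noncomputable def orthPlane (γ : ℝ → EuclideanSpace ℝ (Fin 3)) (θ : ℝ) :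
    Submodule ℝ (EuclideanSpace ℝ (Fin 3)) :=
  (Submodule.span ℝ {γ θ})ᗮ

/-- The orthogonal projection `π_θ` onto the plane `V_θ`, with values in the Euclidean plane
`V_θ` itself, which is isometric to `ℝ²` whenever `γ(θ) ≠ 0`. -/
noncomputable def planeProj (γ : ℝ → EuclideanSpace ℝ (Fin 3)) (θ : ℝ) :
    EuclideanSpace ℝ (Fin 3) → orthPlane γ θ :=
  fun x => (orthPlane γ θ).orthogonalProjectionOnto x

/-! Projections are Lipschitz, so only the lower bounds need work; they follow from Kaufman's
potential-theoretic argument. Given `s < t < dimH B`, Frostman's lemma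
(`AnalyticSet.exists_frostman_measure`) puts on a compact part of `B` a probability measure giving
balls of radius `r` mass at most a constant times `r ^ t`, so its `s`-potential is bounded. Suppose
linear maps `T θ` are transversal of order `p`: for unit `e`, the parameters with `‖T θ e‖ < δ` have
measure at most a constant times `δ ^ p`. For `s < p`, integrating `‖T θ (x - y)‖ ^ (-s)` in `θ`
costs only a constant times `‖x - y‖ ^ (-s)`. By Tonelli almost every image measure has finite
`s`-energy, and finite energy bounds the dimension of the image from below. Since `dimH B ≤ p`,
every `s < dimH B` is admissible (`AnalyticSet.ae_dimH_le_dimH_image`).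

The curve enters only through `p`. For lines, non-degeneracy keeps one of the first three
derivatives (orders 0, 1, 2) of `θ ↦ γ θ · e` away from zero near a given parameter; the worst case,
order 2, gives `√δ`, so `p = 1 / 2`. For planes, a projection of `e` shorter than `δ` forces `γ θ`
within `2 * δ` of `e` or `-e`; as `γ` has nonzero speed, `p = 1`.

Frostman's lemma is obtained from dyadic net contents. They are continuous along increasing unions,
which makes analytic sets capacitable by compact sets; a flow on the tree of dyadic cubes then
yields the measure. -/

open Set Filter Topology
open scoped ENNReal NNReal

/-! ### Net contents and their continuity along increasing unions. -/

section NetContent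

variable {X J : Type*}

/-- The total weight of a family of cells, a cell of generation `k` having weight `w k`. -/
noncomputable def cellCost (w : ℕ → ℝ≥0∞) (D : Set (ℕ × J)) : ℝ≥0∞ :=
  ∑' c, D.indicator (fun c => w c.1) c

/-- The cell `(k, j)` is the set of points `x` with `q k x = j`; the family `D` of cells covers
`E`. -/
def CellCover (q : ℕ → X → J) (D : Set (ℕ × J)) (E : Set X) : Prop :=
  ∀ x ∈ E, ∃ k, (k, q k x) ∈ D

/-- The content of `E` associated with a net of cells. -/
noncomputable def netContent (q : ℕ → X → J) (w : ℕ → ℝ≥0∞) (E : Set X) : ℝ≥0∞ :=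
  ⨅ (D : Set (ℕ × J)) (_ : CellCover q D E), cellCost w D

/-- The cells of `D` that are not contained in a cell of `D` of an earlier generation. -/
def maximalCells (q : ℕ → X → J) (D : Set (ℕ × J)) : Set (ℕ × J) :=
  {c | c ∈ D ∧ ∀ x, q c.1 x = c.2 → ∀ j < c.1, (j, q j x) ∉ D}

variable {q : ℕ → X → J} {w : ℕ → ℝ≥0∞} {D C : Set (ℕ × J)} {A E : Set X}

theorem cellCost_mono (h : D ⊆ C) : cellCost w D ≤ cellCost w C :=
  ENNReal.tsum_le_tsum fun c => indicator_le_indicator_of_subset h (fun _ => zero_le) c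

theorem cellCost_union_add_inter :
    cellCost w (D ∪ C) + cellCost w (D ∩ C) = cellCost w D + cellCost w C := by
  simp only [cellCost, ← ENNReal.tsum_add]
  exact tsum_congr fun c => congrFun (indicator_union_add_inter (fun c : ℕ × J => w c.1) D C) c

theorem cellCost_union_le : cellCost w (D ∪ C) ≤ cellCost w D + cellCost w C :=
  cellCost_union_add_inter (w := w) (D := D) (C := C) ▸ le_self_add

theorem cellCost_empty : cellCost w (∅ : Set (ℕ × J)) = 0 := by simp [cellCost]

theorem cellCost_iUnion_le (D : ℕ → Set (ℕ × J)) :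
    cellCost w (⋃ n, D n) ≤ ∑' n, cellCost w (D n) := by
  simp only [cellCost]
  rw [ENNReal.tsum_comm]
  refine ENNReal.tsum_le_tsum fun c => ?_
  by_cases hc : c ∈ ⋃ n, D n
  · obtain ⟨n, hn⟩ := mem_iUnion.1 hc
    rw [indicator_of_mem hc]
    exact (indicator_of_mem hn (fun c : ℕ × J => w c.1)).symm.le.trans
      (ENNReal.le_tsum (f := fun n => (D n).indicator (fun c : ℕ × J => w c.1) c) n)
  · simp [indicator_of_notMem hc]

theorem cellCost_singleton (c : ℕ × J) : cellCost w {c} = w c.1 := by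
  rw [cellCost, tsum_eq_single c]
  · simp
  · intro b hb; simp [hb]

theorem netContent_le (h : CellCover q D E) : netContent q w E ≤ cellCost w D := iInf₂_le D h

theorem netContent_mono (h : A ⊆ E) : netContent q w A ≤ netContent q w E :=
  le_iInf₂ fun _ hD => netContent_le fun x hx => hD x (h hx)

theorem netContent_empty : netContent q w ∅ = 0 :=
  le_antisymm ((netContent_le (D := ∅) (by simp [CellCover])).trans cellCost_empty.le) zero_le

theorem netContent_cell_le (c : ℕ × J) : netContent q w {x | q c.1 x = c.2} ≤ w c.1 :=
  (netContent_le (D := {c}) fun x hx => ⟨c.1, by ext1 <;> simp_all⟩).trans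
    (cellCost_singleton c).le

theorem exists_cellCover_cost_le (h : netContent q w E ≠ ∞) {ε : ℝ≥0∞} (hε : ε ≠ 0) :
    ∃ D, CellCover q D E ∧ cellCost w D ≤ netContent q w E + ε := by
  by_contra! H
  exact (ENNReal.lt_add_right h hε).not_ge (le_iInf₂ fun D hD => (H D hD).le)

theorem netContent_iUnion_nat_le (A : ℕ → Set X) :
    netContent q w (⋃ n, A n) ≤ ∑' n, netContent q w (A n) := by
  by_cases htop : ∑' n, netContent q w (A n) = ∞
  · simp [htop]
  refine ENNReal.le_of_forall_pos_le_add fun ε hε _ => ?_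
  obtain ⟨δ, hδ, hsum⟩ := ENNReal.exists_pos_sum_of_countable (ENNReal.coe_pos.2 hε).ne' ℕ
  choose D hD hcost using fun n => exists_cellCover_cost_le (q := q) (w := w) (E := A n)
    (ENNReal.ne_top_of_tsum_ne_top htop n) (ENNReal.coe_pos.2 (hδ n)).ne'
  calc netContent q w (⋃ n, A n) ≤ cellCost w (⋃ n, D n) := netContent_le fun x hx => by
        obtain ⟨n, hn⟩ := mem_iUnion.1 hx
        obtain ⟨k, hk⟩ := hD n x hn
        exact ⟨k, mem_iUnion.2 ⟨n, hk⟩⟩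
    _ ≤ ∑' n, cellCost w (D n) := cellCost_iUnion_le D
    _ ≤ ∑' n, (netContent q w (A n) + δ n) := ENNReal.tsum_le_tsum hcost
    _ ≤ _ := by rw [ENNReal.tsum_add]; gcongr

/-- The net content as an outer measure. -/
noncomputable def netOuterMeasure (q : ℕ → X → J) (w : ℕ → ℝ≥0∞) : OuterMeasure X where
  measureOf := netContent q w
  empty := netContent_empty
  mono := netContent_mono
  iUnion_nat A _ := netContent_iUnion_nat_le A

theorem netContent_iUnion_le {ι : Type*} [Countable ι] (A : ι → Set X) :
    netContent q w (⋃ i, A i) ≤ ∑' i, netContent q w (A i) :=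
  measure_iUnion_le (μ := netOuterMeasure q w) A

theorem maximalCells_subset : maximalCells q D ⊆ D := fun _ h => h.1

theorem mem_maximalCells_of_subset {c : ℕ × J} (h : D ⊆ C) (hc : c ∈ maximalCells q C)
    (hD : c ∈ D) : c ∈ maximalCells q D :=
  ⟨hD, fun x hx j hj hmem => hc.2 x hx j hj (h hmem)⟩

theorem eq_of_le_of_refining (hq : ∀ k x y, q (k + 1) x = q (k + 1) y → q k x = q k y)
    {j k : ℕ} (hjk : j ≤ k) {x y : X} (h : q k x = q k y) : q j x = q j y := by
  induction k, hjk using Nat.le_induction with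
  | base => exact h
  | succ k _ ih => exact ih (hq k x y h)

/-- The earliest cell of `D` through a point is maximal: by refinement, all points of that cell lie
in the same cells of earlier generations. -/
theorem CellCover.maximalCells (hq : ∀ k x y, q (k + 1) x = q (k + 1) y → q k x = q k y)
    (h : CellCover q D E) : CellCover q (maximalCells q D) E := by
  classical
  intro x hx
  refine ⟨Nat.find (h x hx), Nat.find_spec (h x hx), fun y hy j hj hmem => ?_⟩
  rw [eq_of_le_of_refining hq hj.le hy] at hmem
  exact Nat.find_min (h x hx) hj hmem

/-- A form of strong subadditivity. Each point of `A` lies in a cell of `D` and in a cell of `C`. If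
the generations differ, the later cell is not maximal; if they agree, the cell is common to both. So
the non-maximal cells together with the common ones still cover `A`. -/
theorem cellCost_maximalCells_union_add_netContent_le (hD : CellCover q D A)
    (hC : CellCover q C A) :
    cellCost w (maximalCells q (D ∪ C)) + netContent q w A ≤ cellCost w D + cellCost w C := by
  have hcov : CellCover q ((D ∪ C) \ maximalCells q (D ∪ C) ∪ D ∩ C) A := by
    intro x hx
    obtain ⟨k, hk⟩ := hD x hx
    obtain ⟨l, hl⟩ := hC x hx
    rcases lt_trichotomy k l with h | rfl | h
    · exact ⟨l, .inl ⟨.inr hl, fun hm => hm.2 x rfl k h (.inl hk)⟩⟩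
    · exact ⟨k, .inr ⟨hk, hl⟩⟩
    · exact ⟨k, .inl ⟨.inl hk, fun hm => hm.2 x rfl l h (.inr hl)⟩⟩
  have hsplit : cellCost w (maximalCells q (D ∪ C)) +
      cellCost w ((D ∪ C) \ maximalCells q (D ∪ C)) = cellCost w (D ∪ C) := by
    rw [← cellCost_union_add_inter, union_sdiff_cancel maximalCells_subset, inter_sdiff_self,
      cellCost_empty, add_zero]
  calc _ ≤ cellCost w (maximalCells q (D ∪ C)) +
        (cellCost w ((D ∪ C) \ maximalCells q (D ∪ C)) + cellCost w (D ∩ C)) := by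
        gcongr
        exact (netContent_le hcov).trans cellCost_union_le
    _ = _ := by rw [← add_assoc, hsplit, cellCost_union_add_inter]

/-- Net contents are continuous along increasing sequences of arbitrary sets. -/
theorem netContent_iUnion_le_iSup (hq : ∀ k x y, q (k + 1) x = q (k + 1) y → q k x = q k y)
    {A : ℕ → Set X} (hA : Monotone A) :
    netContent q w (⋃ n, A n) ≤ ⨆ n, netContent q w (A n) := by
  by_cases htop : ⨆ n, netContent q w (A n) = ∞
  · simp [htop]
  have hfin : ∀ n, netContent q w (A n) ≠ ∞ := fun n =>
    ne_top_of_le_ne_top htop (le_iSup (fun n => netContent q w (A n)) n)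
  refine ENNReal.le_of_forall_pos_le_add fun ε hε _ => ?_
  obtain ⟨δ, hδ, hsum⟩ := ENNReal.exists_pos_sum_of_countable (ENNReal.coe_pos.2 hε).ne' ℕ
  choose C hC hcost using fun n => exists_cellCover_cost_le (q := q) (w := w) (E := A n)
    (hfin n) (ENNReal.coe_pos.2 (hδ n)).ne'
  -- Near-optimal covers are merged one at a time, keeping only maximal cells. The previous lemma,
  -- applied to `A n`, cancels its content, so the excess cost grows by only `δ (n + 1)` at each
  -- merge.
  let D : ℕ → Set (ℕ × J) := fun n => Nat.rec (C 0) (fun n D => maximalCells q (D ∪ C (n + 1))) n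
  have hDsucc : ∀ n, D (n + 1) = maximalCells q (D n ∪ C (n + 1)) := fun n => rfl
  have hDC : ∀ n, D n ⊆ ⋃ m, C m := by
    intro n
    induction n with
    | zero => exact subset_iUnion C 0
    | succ n ih =>
      rw [hDsucc]
      exact maximalCells_subset.trans (union_subset ih (subset_iUnion C (n + 1)))
  have hDcov : ∀ n, CellCover q (D n) (A n) := by
    intro n
    cases n with
    | zero => exact hC 0
    | succ n =>
      rw [hDsucc]
      refine CellCover.maximalCells hq fun x hx => ?_
      obtain ⟨k, hk⟩ := hC (n + 1) x hx
      exact ⟨k, .inr hk⟩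
  have hDcost : ∀ n, cellCost w (D n) ≤
      netContent q w (A n) + ∑ k ∈ Finset.range (n + 1), (δ k : ℝ≥0∞) := by
    intro n
    induction n with
    | zero => simpa using (show cellCost w (D 0) ≤ _ from hcost 0)
    | succ n ih =>
      have h := cellCost_maximalCells_union_add_netContent_le (w := w) (hDcov n)
        (fun x hx => hC (n + 1) x (hA n.le_succ hx))
      rw [← hDsucc] at h
      refine (ENNReal.add_le_add_iff_right (hfin n)).1 (h.trans ((add_le_add ih
        (hcost (n + 1))).trans (le_of_eq ?_)))
      rw [Finset.sum_range_succ _ (n + 1)]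
      ring
  -- A maximal cell of the full union survives every merge after its first appearance. Hence
  -- finitely many such cells lie in a single `D n`, whose cost is controlled.
  have hmax : ∀ c ∈ maximalCells q (⋃ m, C m), ∀ᶠ n in atTop, c ∈ D n := by
    intro c hc
    obtain ⟨m, hm⟩ := mem_iUnion.1 (maximalCells_subset hc)
    refine eventually_atTop.2 ⟨m, fun n hn => ?_⟩
    induction n, hn using Nat.le_induction with
    | base =>
      cases m with
      | zero => exact hm
      | succ m =>
        exact mem_maximalCells_of_subset (union_subset (hDC m) (subset_iUnion C (m + 1))) hc
          (.inr hm)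
    | succ n _ ih =>
      exact mem_maximalCells_of_subset (union_subset (hDC n) (subset_iUnion C (n + 1))) hc
        (.inl ih)
  have hcov : CellCover q (maximalCells q (⋃ m, C m)) (⋃ n, A n) := by
    refine CellCover.maximalCells hq fun x hx => ?_
    obtain ⟨n, hn⟩ := mem_iUnion.1 hx
    obtain ⟨k, hk⟩ := hC n x hn
    exact ⟨k, mem_iUnion.2 ⟨n, hk⟩⟩
  refine (netContent_le hcov).trans (ENNReal.summable.tsum_le_of_sum_le fun s => ?_)
  have hev : ∀ᶠ n in atTop, ∀ c ∈ s,
      (maximalCells q (⋃ m, C m)).indicator (fun c => w c.1) c ≤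
        (D n).indicator (fun c => w c.1) c := by
    refine (Finset.eventually_all s).2 fun c _ => ?_
    by_cases hc : c ∈ maximalCells q (⋃ m, C m)
    · filter_upwards [hmax c hc] with n hn
      simp [hc, hn]
    · exact Eventually.of_forall fun n => by simp [hc]
  obtain ⟨n, hn⟩ := hev.exists
  calc _ ≤ ∑ c ∈ s, (D n).indicator (fun c => w c.1) c := Finset.sum_le_sum hn
    _ ≤ cellCost w (D n) := ENNReal.sum_le_tsum s
    _ ≤ _ := hDcost n
    _ ≤ _ := add_le_add (le_iSup (fun n => netContent q w (A n)) n)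
        ((ENNReal.sum_le_tsum _).trans hsum.le)

end NetContent

/-! ### Capacitability of analytic sets. -/

theorem isCompact_setOf_forall_le (N : ℕ → ℕ) : IsCompact {σ : ℕ → ℕ | ∀ i, σ i ≤ N i} := by
  have : {σ : ℕ → ℕ | ∀ i, σ i ≤ N i} = Set.univ.pi fun i => Iic (N i) := by
    ext; simp [Pi.le_def]
  rw [this]
  exact isCompact_univ_pi fun i => (finite_Iic (N i)).isCompact

/-- Otherwise, truncating counterexamples to their first `k` coordinates gives points of a compact
set. A subsequential limit is also a limit of the untruncated points, since each coordinate is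
eventually unaffected. -/
theorem exists_forall_lt_le_subset_of_isOpen {N : ℕ → ℕ} {V : Set (ℕ → ℕ)} (hV : IsOpen V)
    (hNV : {σ : ℕ → ℕ | ∀ i, σ i ≤ N i} ⊆ V) : ∃ k, {σ : ℕ → ℕ | ∀ i < k, σ i ≤ N i} ⊆ V := by
  by_contra! h
  choose σ hσ hσV using fun k => not_subset.1 (h k)
  have hτ : ∀ k, (fun i => if i < k then σ k i else 0) ∈ {σ : ℕ → ℕ | ∀ i, σ i ≤ N i} := by
    intro k i
    by_cases hi : i < k
    · simpa [hi] using hσ k i hi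
    · simp [hi]
  obtain ⟨τ, hτN, φ, hφ, hlim⟩ :=
    (isCompact_setOf_forall_le N).tendsto_subseq hτ
  have hlim' : Tendsto (σ ∘ φ) atTop (𝓝 τ) := by
    rw [tendsto_pi_nhds] at hlim ⊢
    intro i
    refine (hlim i).congr' ?_
    filter_upwards [hφ.tendsto_atTop.eventually_gt_atTop i] with k hk
    simp [hk]
  obtain ⟨k, hk⟩ := (hlim'.eventually (hV.mem_nhds (hNV hτN))).exists
  exact hσV _ hk

/-- An analytic set contains compact sets all of whose open neighbourhoods have net content
almost as large as the net content of the whole set. -/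
theorem MeasureTheory.AnalyticSet.exists_isCompact_lt_netContent {X J : Type*}
    [TopologicalSpace X] {q : ℕ → X → J} {w : ℕ → ℝ≥0∞}
    (hq : ∀ k x y, q (k + 1) x = q (k + 1) y → q k x = q k y)
    {B : Set X} (hB : AnalyticSet B) {c : ℝ≥0∞} (hc : c < netContent q w B) :
    ∃ K ⊆ B, IsCompact K ∧ ∀ V, IsOpen V → K ⊆ V → c < netContent q w V := by
  rw [AnalyticSet] at hB
  obtain rfl | ⟨f, hf, rfl⟩ := hB
  · simp [netContent_empty] at hc
  have hstep : ∀ (k : ℕ) (S : Set (ℕ → ℕ)), c < netContent q w (f '' S) →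
      ∃ n, c < netContent q w (f '' (S ∩ {σ | σ k ≤ n})) := by
    intro k S hS
    have hS' : f '' S = ⋃ n, f '' (S ∩ {σ | σ k ≤ n}) := by
      rw [← image_iUnion, ← inter_iUnion]
      congr 1
      refine (inter_eq_left.2 fun σ _ => mem_iUnion.2 ⟨σ k, by simp⟩).symm
    rw [hS'] at hS
    exact lt_iSup_iff.1 (hS.trans_le (netContent_iUnion_le_iSup hq fun m n hmn =>
      image_mono (inter_subset_inter_right S fun σ hσ => le_trans hσ hmn)))
  choose! n hn using hstep
  -- Coordinates of Baire space are bounded one after another; continuity along increasing unions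
  -- keeps the content of the image above `c` at every stage.
  let S : ℕ → Set (ℕ → ℕ) := fun k => Nat.rec univ (fun k S => S ∩ {σ | σ k ≤ n k S}) k
  have hSsucc : ∀ k, S (k + 1) = S k ∩ {σ | σ k ≤ n k (S k)} := fun k => rfl
  have hS : ∀ k, c < netContent q w (f '' S k) := by
    intro k
    induction k with
    | zero => simpa [S] using hc
    | succ k ih => exact hn k (S k) ih
  have hSeq : ∀ k, S k = {σ | ∀ i < k, σ i ≤ n i (S i)} := by
    intro k
    induction k with
    | zero => ext; simp [S]
    | succ k ih =>
      rw [hSsucc]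
      ext σ
      simp only [ih, mem_inter_iff, mem_ofPred_eq, Nat.lt_succ_iff_lt_or_eq, or_imp, forall_and,
        forall_eq]
  refine ⟨f '' {σ | ∀ i, σ i ≤ n i (S i)}, image_subset_range _ _,
    (isCompact_setOf_forall_le _).image hf, fun V hV hKV => ?_⟩
  obtain ⟨k, hk⟩ := exists_forall_lt_le_subset_of_isOpen (hV.preimage hf)
    (image_subset_iff.1 hKV)
  rw [← hSeq] at hk
  exact (hS k).trans_le (netContent_mono (image_subset_iff.2 hk))

/-! ### Flows on trees and the measures they define. -/

theorem tsum_comp_mul_eq_of_fiber_sum {I J : Type*} (par : I → J) {f : J → ℝ≥0∞}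
    {g : I → ℝ≥0∞} (hfg : ∀ v, ∑' u : par ⁻¹' {v}, g u = f v) (φ : J → ℝ≥0∞) :
    ∑' u, φ (par u) * g u = ∑' v, φ v * f v := by
  rw [← ENNReal.tsum_fiberwise (fun u => φ (par u) * g u) par]
  refine tsum_congr fun v => ?_
  rw [← hfg v, ← ENNReal.tsum_mul_left]
  refine tsum_congr fun u => ?_
  rw [show par u = v from u.2]

/-- On a locally finite tree, subadditive capacities `a` admit a unit flow from any root `v₀` with
`a 0 v₀ ≠ 0` bounded by the normalised capacities. -/
theorem exists_unit_flow_le {J : Type*} (par : J → J) (hfib : ∀ v, (par ⁻¹' {v}).Finite)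
    {a : ℕ → J → ℝ≥0∞} (hfin : ∀ k v, a k v ≠ ∞)
    (hsub : ∀ k v, a k v ≤ ∑' u : par ⁻¹' {v}, a (k + 1) u) {v₀ : J} (hv₀ : a 0 v₀ ≠ 0) :
    ∃ f : ℕ → J → ℝ≥0∞, ∑' v, f 0 v = 1 ∧ (∀ k v, f k v ≤ a k v / a 0 v₀) ∧
      ∀ k v, ∑' u : par ⁻¹' {v}, f (k + 1) u = f k v := by
  classical
  let S : ℕ → J → ℝ≥0∞ := fun k v => ∑' u : par ⁻¹' {v}, a (k + 1) u
  have hS : ∀ k v, S k v ≠ ∞ := by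
    intro k v
    have := (hfib v).fintype
    simp only [S, tsum_fintype]
    exact ENNReal.sum_ne_top.2 fun u _ => hfin _ _
  -- The mass at a vertex is shared among its children in proportion to their capacities;
  -- subadditivity keeps each share below the normalised capacity.
  let f : ℕ → J → ℝ≥0∞ := fun k => Nat.rec (fun v => if v = v₀ then 1 else 0)
    (fun k g u => g (par u) * (a (k + 1) u / S k (par u))) k
  have hsucc : ∀ k u, f (k + 1) u = f k (par u) * (a (k + 1) u / S k (par u)) :=
    fun k u => rfl
  have hle : ∀ k v, f k v ≤ a k v / a 0 v₀ := by
    intro k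
    induction k with
    | zero =>
      intro v
      change (if v = v₀ then 1 else 0) ≤ _
      split_ifs with h
      · rw [h, ENNReal.div_self hv₀ (hfin _ _)]
      · exact zero_le
    | succ k ih =>
      intro u
      rw [hsucc]
      calc _ ≤ S k (par u) / a 0 v₀ * (a (k + 1) u / S k (par u)) := by
            gcongr
            exact (ih _).trans (ENNReal.div_le_div_right (hsub _ _) _)
        _ = S k (par u) * (a (k + 1) u / S k (par u)) / a 0 v₀ := by
            simp only [div_eq_mul_inv]; ring
        _ ≤ _ := by gcongr; exact ENNReal.mul_div_le
  refine ⟨f, ?_, hle, fun k v => ?_⟩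
  · change ∑' v, (if v = v₀ then 1 else 0) = (1 : ℝ≥0∞)
    simp
  · have : ∀ u : par ⁻¹' {v}, f (k + 1) u = f k v * (a (k + 1) u / S k v) := by
      intro u
      rw [hsucc, show par u = v from u.2]
    rw [tsum_congr this, ENNReal.tsum_mul_left]
    simp only [div_eq_mul_inv]
    rw [ENNReal.tsum_mul_right]
    change f k v * (S k v * (S k v)⁻¹) = f k v
    -- If all children have capacity zero, the shares degenerate, but subadditivity then forces the
    -- flow at `v` to vanish too.
    by_cases h0 : S k v = 0
    · have : f k v = 0 := by
        have := (hle k v).trans (ENNReal.div_le_div_right (hsub k v) _)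
        change _ ≤ S k v / _ at this
        rw [h0, ENNReal.zero_div] at this
        exact le_antisymm this zero_le
      simp [this]
    · rw [ENNReal.mul_inv_cancel h0 (hS k v), mul_one]

/-- A compact set of positive net content carries a probability measure which, up to a constant,
is bounded by the weights of the cells. -/
theorem IsCompact.exists_measure_le_of_netContent_ne_zero {X J : Type*} [MetricSpace X]
    [MeasurableSpace X] [BorelSpace X] [Countable J] {q : ℕ → X → J} {w : ℕ → ℝ≥0∞}
    (hw : ∀ k, w k ≠ ∞) {par : J → J} (hpar : ∀ k x, par (q (k + 1) x) = q k x)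
    (hfib : ∀ v, (par ⁻¹' {v}).Finite) {K : Set X} (hK : IsCompact K)
    (h0 : netContent q w K ≠ 0) :
    ∃ μ : Measure X, IsProbabilityMeasure μ ∧ μ Kᶜ = 0 ∧ ∃ C : ℝ≥0∞, C ≠ ∞ ∧
      ∀ (k : ℕ) (G : Set X) (F : Finset J), IsOpen G → (∀ x ∈ G, q k x ∈ F) →
        μ G ≤ F.card * (C * w k) := by
  classical
  have hq : ∀ k x y, q (k + 1) x = q (k + 1) y → q k x = q k y := fun k x y h => by
    rw [← hpar, h, hpar]
  let a : ℕ → J → ℝ≥0∞ := fun k v => netContent q w (K ∩ {x | q k x = v})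
  have haw : ∀ k v, a k v ≤ w k := fun k v =>
    (netContent_mono inter_subset_right).trans (netContent_cell_le (k, v))
  obtain ⟨v₀, hv₀⟩ : ∃ v₀, a 0 v₀ ≠ 0 := by
    by_contra! h
    refine h0 (le_antisymm ?_ zero_le)
    have hKU : K = ⋃ v, K ∩ {x | q 0 x = v} := by
      rw [← inter_iUnion]
      exact (inter_eq_left.2 fun x _ => mem_iUnion.2 ⟨q 0 x, by simp⟩).symm
    rw [hKU]
    refine (netContent_iUnion_le _).trans ?_
    simp only [a] at h
    simp [h]
  have hKne : K.Nonempty := by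
    rw [nonempty_iff_ne_empty]
    rintro rfl
    exact h0 netContent_empty
  obtain ⟨f, hf0, hfa, hfsum⟩ := exists_unit_flow_le par hfib (a := a)
    (fun k v => ne_top_of_le_ne_top (hw k) (haw k v)) (fun k v => by
      have : K ∩ {x | q k x = v} = ⋃ u : par ⁻¹' {v}, K ∩ {x | q (k + 1) x = u} := by
        ext x
        simp [hpar]
      change netContent q w _ ≤ _
      rw [this]
      exact netContent_iUnion_le _) hv₀
  -- Positive flow through a cell forces the cell to meet `K`, so an atom can be placed there;
  -- elsewhere the choice is irrelevant.
  have hc : ∀ k v, ∃ y : K, f k v ≠ 0 → q k y = v := by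
    intro k v
    by_cases h : (K ∩ {x | q k x = v}).Nonempty
    · obtain ⟨y, hy, hyv⟩ := h
      exact ⟨⟨y, hy⟩, fun _ => hyv⟩
    · refine ⟨⟨hKne.some, hKne.some_mem⟩, fun hf => absurd ?_ hf⟩
      have := hfa k v
      simp only [a, not_nonempty_iff_eq_empty.1 h, netContent_empty, ENNReal.zero_div] at this
      exact le_antisymm this zero_le
  choose c hc using hc
  -- The atoms of generation `m` carry the flow `f k` on the cells of every generation `k ≤ m`.
  have key : ∀ (ψ : J → ℝ≥0∞) (k m : ℕ), k ≤ m →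
      ∑' u, ψ (q k (c m u)) * f m u = ∑' v, ψ v * f k v := by
    intro ψ k m hkm
    induction m, hkm using Nat.le_induction with
    | base =>
      refine tsum_congr fun v => ?_
      by_cases h : f k v = 0
      · simp [h]
      · rw [hc k v h]
    | succ m hkm ih =>
      rw [← ih, ← tsum_comp_mul_eq_of_fiber_sum par (hfsum m) fun v => ψ (q k (c m v))]
      refine tsum_congr fun u => ?_
      by_cases h : f (m + 1) u = 0
      · simp [h]
      have h' : f m (par u) ≠ 0 := by
        rw [← hfsum m (par u)]
        refine fun hz => h ?_
        exact ENNReal.tsum_eq_zero.1 hz ⟨u, rfl⟩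
      have hu : q m (c (m + 1) u) = q m (c m (par u)) := by
        rw [hc m _ h', ← hpar, hc (m + 1) u h]
      rw [eq_of_le_of_refining hq hkm hu]
  let P : ℕ → Measure K := fun m => Measure.sum fun u => f m u • Measure.dirac (c m u)
  have hP : ∀ m, IsProbabilityMeasure (P m) := by
    intro m
    refine ⟨?_⟩
    have h1 := key 1 0 m m.zero_le
    simp only [Pi.one_apply, one_mul, hf0] at h1
    simp [P, Measure.sum_apply _ MeasurableSet.univ, h1]
  have hPle : ∀ (k m : ℕ) (G : Set X) (F : Finset J), k ≤ m → IsOpen G →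
      (∀ x ∈ G, q k x ∈ F) → P m ((↑) ⁻¹' G) ≤ F.card * ((a 0 v₀)⁻¹ * w k) := by
    intro k m G F hkm hG hGF
    have hGm : MeasurableSet ((↑) ⁻¹' G : Set K) :=
      (hG.preimage continuous_subtype_val).measurableSet
    calc P m ((↑) ⁻¹' G)
        = ∑' u, f m u * ((↑) ⁻¹' G : Set K).indicator 1 (c m u) := by
          simp [P, Measure.sum_apply _ hGm, Measure.dirac_apply' _ hGm]
      _ ≤ ∑' u, (F : Set J).indicator 1 (q k (c m u)) * f m u := by
          refine ENNReal.tsum_le_tsum fun u => ?_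
          rw [mul_comm]
          gcongr
          by_cases hu : (c m u : X) ∈ G
          · simp [hu, hGF _ hu]
          · simp [hu]
      _ = ∑' v, (F : Set J).indicator 1 v * f k v := key _ k m hkm
      _ = ∑ v ∈ F, f k v := by
          rw [tsum_eq_sum (s := F)]
          · exact Finset.sum_congr rfl fun v hv => by simp [hv]
          · intro v hv
            simp [hv]
      _ ≤ ∑ v ∈ F, (a 0 v₀)⁻¹ * w k := Finset.sum_le_sum fun v _ => by
          rw [mul_comm, ← div_eq_mul_inv]
          exact (hfa k v).trans (ENNReal.div_le_div_right (haw k v) _)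
      _ = _ := by simp
  have hKc : CompactSpace K := isCompact_iff_compactSpace.1 hK
  let PM : ℕ → ProbabilityMeasure K := fun m => ⟨P m, hP m⟩
  -- Probability measures on the compact `K` form a compact space, so a limit exists along an
  -- ultrafilter. Upper bounds pass to the limit on open sets, which is why `G` is open.
  let L : Ultrafilter (ProbabilityMeasure K) := (hyperfilter ℕ).map PM
  have hL : Tendsto PM (hyperfilter ℕ) (𝓝 L.lim) := L.le_nhds_lim
  refine ⟨(L.lim : Measure K).map (↑), Measure.isProbabilityMeasure_map (by fun_prop), ?_,
    (a 0 v₀)⁻¹, ENNReal.inv_ne_top.2 hv₀, fun k G F hG hGF => ?_⟩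
  · rw [Measure.map_apply measurable_subtype_coe hK.measurableSet.compl]
    simp
  · rw [Measure.map_apply measurable_subtype_coe hG.measurableSet]
    refine (ProbabilityMeasure.le_liminf_measure_open_of_tendsto hL
      (hG.preimage continuous_subtype_val)).trans (liminf_le_of_frequently_le' ?_)
    refine Eventually.frequently ?_
    have hev : ∀ᶠ m in (hyperfilter ℕ : Filter ℕ), k ≤ m :=
      (Nat.hyperfilter_le_atTop) (eventually_ge_atTop k)
    filter_upwards [hev] with m hm
    exact hPle k m G F hm hG hGF

/-! ### Dyadic cubes and Frostman's lemma. -/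

section Dyadic

variable {ι : Type*}

/-- The index of the half-open dyadic cube of side length `2⁻ᵏ` that contains `x`. -/
noncomputable def dyadicIndex (k : ℕ) (x : EuclideanSpace ℝ ι) : ι → ℤ :=
  fun i => ⌊2 ^ k * x i⌋

theorem dyadicIndex_succ_div_two (k : ℕ) (x : EuclideanSpace ℝ ι) :
    (fun i => dyadicIndex (k + 1) x i / 2) = dyadicIndex k x := by
  ext i
  have := Int.floor_div_natCast ((2 : ℝ) ^ (k + 1) * x i) 2
  simp only [dyadicIndex]
  rw [show (2 : ℝ) ^ k * x i = 2 ^ (k + 1) * x i / (2 : ℕ) by push_cast; ring, this]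
  rfl

theorem dyadicIndex_refining (k : ℕ) (x y : EuclideanSpace ℝ ι)
    (h : dyadicIndex (k + 1) x = dyadicIndex (k + 1) y) : dyadicIndex k x = dyadicIndex k y := by
  rw [← dyadicIndex_succ_div_two, h, dyadicIndex_succ_div_two]

/-- The weight `(2⁻ᵏ)ᵗ` of a dyadic cube of generation `k`. -/
noncomputable def dyadicWeight (t : ℝ) (k : ℕ) : ℝ≥0∞ := (2⁻¹ ^ k : ℝ≥0∞) ^ t

theorem dyadicWeight_ne_top {t : ℝ} (ht : 0 ≤ t) (k : ℕ) : dyadicWeight t k ≠ ∞ :=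
  ENNReal.rpow_ne_top_of_nonneg ht (ENNReal.pow_ne_top (by simp))

theorem dyadicWeight_ne_zero {t : ℝ} (ht : 0 ≤ t) (k : ℕ) : dyadicWeight t k ≠ 0 := by
  simp [dyadicWeight, ENNReal.rpow_eq_zero_iff, ht.not_gt]

theorem dyadicWeight_eq_pow (t : ℝ) (k : ℕ) : dyadicWeight t k = ((2⁻¹ : ℝ≥0∞) ^ t) ^ k := by
  rw [dyadicWeight, ← ENNReal.rpow_natCast, ← ENNReal.rpow_natCast, ← ENNReal.rpow_mul,
    ← ENNReal.rpow_mul, mul_comm]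

theorem rpow_inv_two_lt_one {t : ℝ} (ht : 0 < t) : (2⁻¹ : ℝ≥0∞) ^ t < 1 :=
  ENNReal.rpow_lt_one (ENNReal.inv_lt_one.2 ENNReal.one_lt_two) ht

theorem tendsto_dyadicWeight {t : ℝ} (ht : 0 < t) : Tendsto (dyadicWeight t) atTop (𝓝 0) := by
  simp only [funext (dyadicWeight_eq_pow t)]
  exact ENNReal.tendsto_pow_atTop_nhds_zero_of_lt_one (rpow_inv_two_lt_one ht)

variable [Fintype ι]

theorem edist_le_of_dyadicIndex_eq {k : ℕ} {x y : EuclideanSpace ℝ ι}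
    (h : dyadicIndex k x = dyadicIndex k y) :
    edist x y ≤ ((Fintype.card ι : ℝ≥0) ^ (1 / (2 : ℝ≥0∞)).toReal : ℝ≥0) * 2⁻¹ ^ k := by
  refine (PiLp.antilipschitzWith_ofLp 2 (fun _ : ι => ℝ) x y).trans ?_
  gcongr
  refine edist_pi_le_iff.2 fun i => ?_
  have hi : ⌊(2 : ℝ) ^ k * x i⌋ = ⌊2 ^ k * y i⌋ := congrFun h i
  have hlt := Int.abs_sub_lt_one_of_floor_eq_floor hi
  have h2 : (0 : ℝ) < 2 ^ k := by positivity
  rw [← mul_sub, abs_mul, abs_of_pos h2] at hlt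
  rw [edist_dist, Real.dist_eq]
  have : (2⁻¹ ^ k : ℝ≥0∞) = ENNReal.ofReal (2⁻¹ ^ k) := by
    rw [ENNReal.ofReal_pow (by norm_num), ENNReal.ofReal_inv_of_pos (by norm_num),
      ENNReal.ofReal_ofNat]
  rw [this]
  refine ENNReal.ofReal_le_ofReal ?_
  rw [inv_pow, ← one_div, le_div_iff₀ h2, mul_comm]
  exact hlt.le

/-- No mesh restriction is needed: in a cover of cost at most `dyadicWeight t n` each cell weighs at
most that much, so it has generation at least `n` and its diameter tends to zero with the cost. -/
theorem hausdorffMeasure_eq_zero_of_netContent_eq_zero {t : ℝ} (ht : 0 < t)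
    {B : Set (EuclideanSpace ℝ ι)} (h : netContent dyadicIndex (dyadicWeight t) B = 0) :
    μH[t] B = 0 := by
  set κ : ℝ≥0∞ := (((Fintype.card ι : ℝ≥0) ^ (1 / (2 : ℝ≥0∞)).toReal : ℝ≥0) : ℝ≥0∞) with hκ
  have hκtop : κ ≠ ∞ := ENNReal.coe_ne_top
  choose D hD hcost using fun n : ℕ => exists_cellCover_cost_le
    (q := dyadicIndex (ι := ι)) (w := dyadicWeight t) (E := B) (by simp [h])
    (dyadicWeight_ne_zero ht.le n)
  simp only [h, zero_add] at hcost
  let T : ℕ → ℕ × (ι → ℤ) → Set (EuclideanSpace ℝ ι) :=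
    fun n c => {x | c ∈ D n ∧ dyadicIndex c.1 x = c.2}
  have hdiam : ∀ n c, Metric.ediam (T n c) ≤ κ * 2⁻¹ ^ c.1 := fun n c =>
    Metric.ediam_le fun x hx y hy => edist_le_of_dyadicIndex_eq (hx.2.trans hy.2.symm)
  have hTempty : ∀ n c, c ∉ D n → T n c = ∅ := fun n c hc => by ext x; simp [T, hc]
  have hpow : Tendsto (fun n : ℕ => κ * 2⁻¹ ^ n) atTop (𝓝 0) := by
    have := ENNReal.Tendsto.const_mul (a := κ) (ENNReal.tendsto_pow_atTop_nhds_zero_of_lt_one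
      (ENNReal.inv_lt_one.2 ENNReal.one_lt_two)) (.inr hκtop)
    simpa using this
  have hlim : Tendsto (fun n => ∑' c, Metric.ediam (T n c) ^ t) atTop (𝓝 0) := by
    have h0 : Tendsto (fun n => κ ^ t * dyadicWeight t n) atTop (𝓝 0) := by
      have := ENNReal.Tendsto.const_mul (a := κ ^ t) (tendsto_dyadicWeight ht)
        (.inr (ENNReal.rpow_ne_top_of_nonneg ht.le hκtop))
      simpa using this
    refine tendsto_of_tendsto_of_tendsto_of_le_of_le tendsto_const_nhds h0
      (fun _ => zero_le) fun n => ?_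
    calc ∑' c, Metric.ediam (T n c) ^ t
        ≤ ∑' c, κ ^ t * (D n).indicator (fun c => dyadicWeight t c.1) c := by
          refine ENNReal.tsum_le_tsum fun c => ?_
          by_cases hc : c ∈ D n
          · rw [indicator_of_mem hc, dyadicWeight, ← ENNReal.mul_rpow_of_nonneg _ _ ht.le]
            exact ENNReal.rpow_le_rpow (hdiam n c) ht.le
          · simp [hTempty n c hc, ht]
      _ = κ ^ t * cellCost (dyadicWeight t) (D n) := ENNReal.tsum_mul_left
      _ ≤ _ := by gcongr; exact hcost n
  refine le_antisymm ?_ zero_le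
  rw [← hlim.liminf_eq]
  refine Measure.hausdorffMeasure_le_liminf_tsum t B _ hpow T
    (Eventually.of_forall fun n c => ?_) (Eventually.of_forall fun n x hx => ?_)
  · by_cases hc : c ∈ D n
    · have : dyadicWeight t c.1 ≤ dyadicWeight t n := by
        refine le_trans ?_ (hcost n)
        rw [← cellCost_singleton (w := dyadicWeight t) c]
        exact cellCost_mono (singleton_subset_iff.2 hc)
      exact (hdiam n c).trans (mul_le_mul_right ((ENNReal.rpow_le_rpow_iff ht).1 this) κ)
    · simp [hTempty n c hc]
  · obtain ⟨k, hk⟩ := hD n x hx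
    exact mem_iUnion.2 ⟨(k, dyadicIndex k x), hk, rfl⟩

theorem netContent_le_card_mul {X J : Type*} {q : ℕ → X → J} {w : ℕ → ℝ≥0∞} {E : Set X} {k : ℕ}
    (F : Finset J) (h : ∀ x ∈ E, q k x ∈ F) : netContent q w E ≤ F.card * w k := by
  have hE : E ⊆ ⋃ v : F, {x | q k x = v} := fun x hx =>
    mem_iUnion.2 ⟨⟨q k x, h x hx⟩, rfl⟩
  refine (netContent_mono hE).trans ((netContent_iUnion_le _).trans ?_)
  rw [tsum_fintype]
  calc ∑ v : F, netContent q w {x | q k x = v} ≤ ∑ _v : F, w k :=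
        Finset.sum_le_sum fun v _ => netContent_cell_le (q := q) (w := w) (k, (v : J))
    _ = _ := by simp

theorem card_Icc_sub_one_add_one [DecidableEq ι] (v : ι → ℤ) :
    (Finset.Icc (v - 1) (v + 1)).card = 3 ^ Fintype.card ι := by
  rw [Pi.card_Icc]
  have : ∀ i, (Finset.Icc ((v - 1) i) ((v + 1) i)).card = 3 := fun i => by simp; omega
  rw [Finset.prod_congr rfl fun i _ => this i, Finset.prod_const, Finset.card_univ]

/-- Each cube of a cheap cover is enlarged to the open cube of triple side, which is covered by `3 ^
card ι` cubes of the same generation. This turns the content bound on neighbourhoods of `K` into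
positivity of the content of `K` itself. -/
theorem exists_isOpen_netContent_le_of_netContent_eq_zero {t : ℝ}
    {K : Set (EuclideanSpace ℝ ι)} (h : netContent dyadicIndex (dyadicWeight t) K = 0)
    {ε : ℝ≥0∞} (hε : ε ≠ 0) :
    ∃ V, IsOpen V ∧ K ⊆ V ∧
      netContent dyadicIndex (dyadicWeight t) V ≤ 3 ^ Fintype.card ι * ε := by
  classical
  obtain ⟨D, hD, hcost⟩ := exists_cellCover_cost_le (q := dyadicIndex (ι := ι))
    (w := dyadicWeight t) (E := K) (by simp [h]) hε
  rw [h, zero_add] at hcost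
  let W : ℕ × (ι → ℤ) → Set (EuclideanSpace ℝ ι) :=
    fun c => {x | ∀ i, (c.2 i : ℝ) - 1 < 2 ^ c.1 * x i ∧
      2 ^ c.1 * x i < (c.2 i : ℝ) + 2}
  have hWopen : ∀ c, IsOpen (W c) := by
    intro c
    have : W c = ⋂ i, {x | (c.2 i : ℝ) - 1 < 2 ^ c.1 * x i ∧
        2 ^ c.1 * x i < (c.2 i : ℝ) + 2} := by
      ext; simp [W]
    rw [this]
    refine isOpen_iInter_of_finite fun i => ?_
    have hcont : Continuous fun x : EuclideanSpace ℝ ι => 2 ^ c.1 * x i := by fun_prop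
    exact (isOpen_lt continuous_const hcont).inter (isOpen_lt hcont continuous_const)
  have hWcost : ∀ c, netContent dyadicIndex (dyadicWeight t) (W c) ≤
      3 ^ Fintype.card ι * dyadicWeight t c.1 := by
    intro c
    refine (netContent_le_card_mul (k := c.1) (Finset.Icc (c.2 - 1) (c.2 + 1)) ?_).trans ?_
    · intro x hx
      rw [Finset.mem_Icc]
      refine ⟨fun i => ?_, fun i => ?_⟩
      · refine Int.le_floor.2 ?_
        simpa using (hx i).1.le
      · refine Int.lt_add_one_iff.1 (Int.floor_lt.2 ?_)
        have := (hx i).2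
        simp only [Pi.add_apply, Pi.one_apply]
        push_cast
        linarith
    · rw [card_Icc_sub_one_add_one]
      simp
  refine ⟨⋃ c : D, W c, isOpen_iUnion fun c => hWopen c, fun x hx => ?_, ?_⟩
  · obtain ⟨k, hk⟩ := hD x hx
    refine mem_iUnion.2 ⟨⟨_, hk⟩, fun i => ⟨?_, ?_⟩⟩
    · have := Int.floor_le ((2 : ℝ) ^ k * x i)
      simp only [dyadicIndex]
      linarith
    · have := Int.lt_floor_add_one ((2 : ℝ) ^ k * x i)
      simp only [dyadicIndex]
      linarith
  · calc _ ≤ ∑' c : D, netContent dyadicIndex (dyadicWeight t) (W c) := netContent_iUnion_le _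
      _ ≤ ∑' c : D, 3 ^ Fintype.card ι * dyadicWeight t c.1.1 :=
          ENNReal.tsum_le_tsum fun c => hWcost c
      _ = 3 ^ Fintype.card ι * cellCost (dyadicWeight t) D := by
          rw [ENNReal.tsum_mul_left, cellCost,
            tsum_subtype D fun c : ℕ × (ι → ℤ) => dyadicWeight t c.1]
      _ ≤ _ := by gcongr

/-- **Frostman's lemma** for analytic sets. -/
theorem MeasureTheory.AnalyticSet.exists_frostman_measure {t : ℝ} (ht : 0 < t)
    {B : Set (EuclideanSpace ℝ ι)} (hB : AnalyticSet B) (h : μH[t] B ≠ 0) :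
    ∃ K ⊆ B, IsCompact K ∧ ∃ μ : Measure (EuclideanSpace ℝ ι), IsProbabilityMeasure μ ∧
      μ Kᶜ = 0 ∧ ∃ C : ℝ≥0∞, C ≠ ∞ ∧
        ∀ x (k : ℕ), μ {y | edist x y < 2⁻¹ ^ k} ≤ C * (2⁻¹ ^ k) ^ t := by
  classical
  have hB0 : 0 < netContent dyadicIndex (dyadicWeight t) B :=
    pos_iff_ne_zero.2 fun h0 => h (hausdorffMeasure_eq_zero_of_netContent_eq_zero ht h0)
  obtain ⟨c, hc0, hc⟩ := exists_between hB0
  obtain ⟨K, hKB, hK, hKV⟩ := hB.exists_isCompact_lt_netContent dyadicIndex_refining hc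
  have h3 : (3 ^ Fintype.card ι : ℝ≥0∞) ≠ 0 := by simp
  have h3' : (3 ^ Fintype.card ι : ℝ≥0∞) ≠ ∞ := ENNReal.pow_ne_top (by simp)
  have hK0 : netContent dyadicIndex (dyadicWeight t) K ≠ 0 := by
    intro hK0
    obtain ⟨V, hV, hKsub, hle⟩ := exists_isOpen_netContent_le_of_netContent_eq_zero hK0
      (ε := c / 3 ^ Fintype.card ι) (ENNReal.div_ne_zero.2 ⟨hc0.ne', h3'⟩)
    rw [ENNReal.mul_div_cancel h3 h3'] at hle
    exact (hKV V hV hKsub).not_ge hle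
  obtain ⟨μ, hμ, hμK, C, hC, hle⟩ := hK.exists_measure_le_of_netContent_ne_zero
    (dyadicWeight_ne_top ht.le) (par := fun v i => v i / 2) dyadicIndex_succ_div_two
    (fun v => (finite_Icc (fun i => 2 * v i) (fun i => 2 * v i + 1)).subset fun u hu => by
      have hu' : ∀ i, u i / 2 = v i := fun i => congrFun hu i
      exact ⟨fun i => by have := hu' i; dsimp; omega, fun i => by have := hu' i; dsimp; omega⟩)
    hK0
  refine ⟨K, hKB, hK, μ, hμ, hμK, 3 ^ Fintype.card ι * C, ENNReal.mul_ne_top h3' hC,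
    fun x k => ?_⟩
  -- A ball of radius `2⁻ᵏ` meets only the cube of its centre and the adjacent ones.
  refine (hle k _ (Finset.Icc (dyadicIndex k x - 1) (dyadicIndex k x + 1))
    (isOpen_lt (by fun_prop) (by fun_prop)) fun y hy => ?_).trans (le_of_eq ?_)
  · have hxy : ∀ i, |(2 : ℝ) ^ k * x i - 2 ^ k * y i| < 1 := by
      intro i
      have h2 : (0 : ℝ) < 2 ^ k := by positivity
      have h1 : edist x y < ENNReal.ofReal (2⁻¹ ^ k) := by
        rw [ENNReal.ofReal_pow (by norm_num), ENNReal.ofReal_inv_of_pos (by norm_num),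
          ENNReal.ofReal_ofNat]
        exact hy
      rw [edist_dist, ENNReal.ofReal_lt_ofReal_iff (by positivity), dist_eq_norm] at h1
      have h3 : |x i - y i| < 2⁻¹ ^ k :=
        ((PiLp.norm_apply_le (x - y) i).trans_lt h1)
      rw [← mul_sub, abs_mul, abs_of_pos h2]
      rwa [inv_pow, ← one_div, lt_div_iff₀ h2, mul_comm] at h3
    rw [Finset.mem_Icc]
    refine ⟨fun i => ?_, fun i => ?_⟩
    · refine Int.le_floor.2 ?_
      have h1 := Int.floor_le ((2 : ℝ) ^ k * x i)
      have h2 := (abs_lt.1 (hxy i)).2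
      simp only [dyadicIndex, Pi.sub_apply, Pi.one_apply]
      push_cast
      linarith
    · refine Int.lt_add_one_iff.1 (Int.floor_lt.2 ?_)
      have h1 := Int.lt_floor_add_one ((2 : ℝ) ^ k * x i)
      have h2 := (abs_lt.1 (hxy i)).1
      simp only [dyadicIndex, Pi.add_apply, Pi.one_apply]
      push_cast
      linarith
  · rw [card_Icc_sub_one_add_one, dyadicWeight]
    push_cast
    ring

end Dyadic

/-! ### Riesz energies and Hausdorff dimension. -/

/-- For `2⁻¹ ^ (j + 1) ≤ x < 2⁻¹ ^ j` the term `k = j` alone suffices; at `x = 0` every term is at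
least `1`, so the sum is infinite. -/
theorem inv_rpow_le_one_add_tsum (x : ℝ≥0∞) {s : ℝ} (hs : 0 ≤ s) :
    (x ^ s)⁻¹ ≤ 1 + ∑' k : ℕ, (Iio (2⁻¹ ^ k : ℝ≥0∞)).indicator
      (fun _ => (dyadicWeight s (k + 1))⁻¹) x := by
  rcases le_or_gt 1 x with h1 | h1
  · refine (ENNReal.inv_le_one.2 ?_).trans le_self_add
    simpa using ENNReal.rpow_le_rpow h1 hs
  rcases eq_or_ne x 0 with rfl | h0
  · refine le_top.trans (le_of_eq ?_)
    symm
    rw [ENNReal.add_eq_top]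
    right
    rw [eq_top_iff, ← ENNReal.tsum_const_eq_top_of_ne_zero (α := ℕ) (c := 1) one_ne_zero]
    refine ENNReal.tsum_le_tsum fun k => ?_
    rw [indicator_of_mem (by simp [pos_iff_ne_zero])]
    refine ENNReal.one_le_inv.2 (ENNReal.rpow_le_one ?_ hs)
    exact pow_le_one₀ zero_le (ENNReal.inv_le_one.2 one_le_two)
  · have hex : ∃ k : ℕ, (2⁻¹ : ℝ≥0∞) ^ k ≤ x :=
      ((ENNReal.tendsto_pow_atTop_nhds_zero_of_lt_one
        (ENNReal.inv_lt_one.2 ENNReal.one_lt_two)).eventually_le_const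
          (pos_iff_ne_zero.2 h0)).exists
    classical
    obtain ⟨j, hj⟩ : ∃ j, Nat.find hex = j + 1 := by
      refine Nat.exists_eq_succ_of_ne_zero fun h => ?_
      have := Nat.find_spec hex
      rw [h, pow_zero] at this
      exact h1.not_ge this
    have hlow := Nat.find_spec hex
    rw [hj] at hlow
    have hup : x < 2⁻¹ ^ j := not_le.1 (Nat.find_min hex (by omega))
    calc (x ^ s)⁻¹ ≤ (dyadicWeight s (j + 1))⁻¹ :=
          ENNReal.inv_le_inv.2 (ENNReal.rpow_le_rpow hlow hs)
      _ = (Iio (2⁻¹ ^ j : ℝ≥0∞)).indicator (fun _ => (dyadicWeight s (j + 1))⁻¹) x := by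
          rw [indicator_of_mem (mem_Iio.2 hup)]
      _ ≤ _ := (ENNReal.le_tsum (f := fun k : ℕ => (Iio (2⁻¹ ^ k : ℝ≥0∞)).indicator
            (fun _ => (dyadicWeight s (k + 1))⁻¹) x) j).trans le_add_self

/-- Integrating the dyadic bound gives a geometric series of ratio `2⁻¹ ^ (t - s)`, finite when `s <
t`. It serves twice: for potentials of Frostman measures and for integrals over the parameter. -/
theorem lintegral_inv_rpow_le {α : Type*} [MeasurableSpace α] {μ : Measure α} {h : α → ℝ≥0∞}
    (hh : Measurable h) {s t : ℝ} (hs : 0 ≤ s) {C : ℝ≥0∞}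
    (hC : ∀ k : ℕ, μ {a | h a < 2⁻¹ ^ k} ≤ C * (2⁻¹ ^ k) ^ t) :
    ∫⁻ a, (h a ^ s)⁻¹ ∂μ ≤
      μ univ + C * ((2⁻¹ ^ s)⁻¹ * (1 - 2⁻¹ ^ (t - s))⁻¹) := by
  have hmeas : ∀ k : ℕ, MeasurableSet {a | h a < 2⁻¹ ^ k} := fun k =>
    measurableSet_lt hh measurable_const
  calc ∫⁻ a, (h a ^ s)⁻¹ ∂μ
      ≤ ∫⁻ a, 1 + ∑' k : ℕ, {a | h a < 2⁻¹ ^ k}.indicator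
          (fun _ => (dyadicWeight s (k + 1))⁻¹) a ∂μ :=
        lintegral_mono fun a => inv_rpow_le_one_add_tsum (h a) hs
    _ = μ univ + ∑' k : ℕ, (dyadicWeight s (k + 1))⁻¹ * μ {a | h a < 2⁻¹ ^ k} := by
        rw [lintegral_add_left measurable_const, lintegral_one, lintegral_tsum fun k =>
          (measurable_const.indicator (hmeas k)).aemeasurable]
        congr 2
        ext k
        rw [lintegral_indicator_const (hmeas k)]
    _ ≤ μ univ + ∑' k : ℕ, C * ((2⁻¹ ^ s)⁻¹ * (2⁻¹ ^ (t - s)) ^ k) := by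
        refine add_le_add le_rfl (ENNReal.tsum_le_tsum fun k => ?_)
        calc _ ≤ (dyadicWeight s (k + 1))⁻¹ * (C * dyadicWeight t k) := by
              gcongr; exact hC k
          _ = C * ((2⁻¹ ^ s)⁻¹ * (2⁻¹ ^ (t - s)) ^ k) := by
              have h0 : (2⁻¹ : ℝ≥0∞) ^ s ≠ 0 := by simp [hs.not_gt]
              have htop : (2⁻¹ : ℝ≥0∞) ^ s ≠ ∞ := ENNReal.rpow_ne_top_of_nonneg hs (by simp)
              have hts : (2⁻¹ : ℝ≥0∞) ^ t = 2⁻¹ ^ s * 2⁻¹ ^ (t - s) := by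
                rw [← ENNReal.rpow_add _ _ (by simp) (by simp)]
                congr 1
                ring
              rw [dyadicWeight_eq_pow, dyadicWeight_eq_pow, hts, mul_pow, pow_succ,
                ENNReal.mul_inv (.inr htop) (.inr h0)]
              calc _ = (((2⁻¹ : ℝ≥0∞) ^ s) ^ k)⁻¹ * ((2⁻¹ : ℝ≥0∞) ^ s) ^ k *
                    (C * ((2⁻¹ ^ s)⁻¹ * (2⁻¹ ^ (t - s)) ^ k)) := by ring
                _ = _ := by
                  rw [ENNReal.inv_mul_cancel (pow_ne_zero k h0) (ENNReal.pow_ne_top htop),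
                    one_mul]
    _ = _ := by rw [ENNReal.tsum_mul_left, ENNReal.tsum_mul_left, ENNReal.tsum_geometric]

theorem energyConstant_ne_top {s t : ℝ} (hs : 0 ≤ s) (hst : s < t) :
    ((2⁻¹ : ℝ≥0∞) ^ s)⁻¹ * (1 - 2⁻¹ ^ (t - s))⁻¹ ≠ ∞ := by
  refine ENNReal.mul_ne_top (ENNReal.inv_ne_top.2 (by simp [hs.not_gt])) (ENNReal.inv_ne_top.2 ?_)
  exact (tsub_pos_of_lt (rpow_inv_two_lt_one (sub_pos.2 hst))).ne'

/-- If the image of a nonzero measure on a compact set `K` under `T` has finite `s`-energy, then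
`T '' K` has Hausdorff dimension at least `s`. -/
theorem le_dimH_image_of_energy_ne_top {X Y : Type*} [TopologicalSpace X] [MeasurableSpace X]
    [BorelSpace X] [MetricSpace Y] [SecondCountableTopology Y] [MeasurableSpace Y] [BorelSpace Y]
    {μ : Measure X} [SFinite μ] (hμ : μ ≠ 0) {K : Set X} (hK : IsCompact K) (hμK : μ Kᶜ = 0)
    {T : X → Y} (hT : Continuous T) {s : ℝ≥0} (hs : 0 < s)
    (hE : ∫⁻ x, ∫⁻ y, (edist (T x) (T y) ^ (s : ℝ))⁻¹ ∂μ ∂μ ≠ ∞) : s ≤ dimH (T '' K) := by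
  have hs' : (0 : ℝ) < s := hs
  have hTm : Measurable T := hT.measurable
  set φ : X → ℝ≥0∞ := fun x => ∫⁻ y, (edist (T x) (T y) ^ (s : ℝ))⁻¹ ∂μ with hφdef
  have hφ : Measurable φ := by
    refine Measurable.lintegral_prod_right' (f := fun p : X × X =>
      (edist (T p.1) (T p.2) ^ (s : ℝ))⁻¹) ?_
    exact (((hTm.comp measurable_fst).edist (hTm.comp measurable_snd)).pow_const _).inv
  -- Finite energy makes the potential finite almost everywhere, hence bounded by some `n` on a set
  -- of positive measure. There the image measure obeys a mass distribution bound.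
  obtain ⟨n, hn⟩ : ∃ n : ℕ, μ {x | φ x ≤ n} ≠ 0 := by
    by_contra! h
    have h1 : μ (⋃ n : ℕ, {x | φ x ≤ n}) = 0 := measure_iUnion_null h
    have h2 : ∀ᵐ x ∂μ, φ x < ∞ := ae_lt_top hφ hE
    refine hμ (Measure.measure_univ_eq_zero.1 ?_)
    refine le_antisymm ((measure_mono (t := (⋃ n : ℕ, {x | φ x ≤ n}) ∪ {x | ¬ φ x < ∞})
      fun x _ => ?_).trans ((measure_union_le _ _).trans ?_)) zero_le
    · by_cases hx : φ x < ∞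
      · obtain ⟨n, hn⟩ := ENNReal.exists_nat_gt hx.ne
        exact .inl (mem_iUnion.2 ⟨n, hn.le⟩)
      · exact .inr hx
    · rw [h1, ae_iff.1 h2, add_zero]
  set A := {x | φ x ≤ n} with hA
  have hAm : MeasurableSet A := measurableSet_le hφ measurable_const
  have hball : ∀ S : Set Y, Metric.ediam S ≤ 1 → MeasurableSet S →
      μ (T ⁻¹' S ∩ A) ≤ n * Metric.ediam S ^ (s : ℝ) := by
    intro S hS1 hSm
    rcases (T ⁻¹' S ∩ A).eq_empty_or_nonempty with h | ⟨x, hxS, hxA⟩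
    · simp [h]
    have hdtop : Metric.ediam S ^ (s : ℝ) ≠ ∞ :=
      ENNReal.rpow_ne_top_of_nonneg hs'.le (ne_top_of_le_ne_top ENNReal.one_ne_top hS1)
    have hle : (Metric.ediam S ^ (s : ℝ))⁻¹ * μ (T ⁻¹' S) ≤ n := by
      calc _ = ∫⁻ _ in T ⁻¹' S, (Metric.ediam S ^ (s : ℝ))⁻¹ ∂μ := by
            rw [setLIntegral_const]
        _ ≤ ∫⁻ y in T ⁻¹' S, (edist (T x) (T y) ^ (s : ℝ))⁻¹ ∂μ := by
            refine setLIntegral_mono' (hTm hSm) fun y hy => ?_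
            exact ENNReal.inv_le_inv.2 (ENNReal.rpow_le_rpow
              (Metric.edist_le_ediam_of_mem hxS hy) hs'.le)
        _ ≤ φ x := setLIntegral_le_lintegral _ _
        _ ≤ n := hxA
    refine (measure_mono inter_subset_left).trans ?_
    rcases eq_or_ne (Metric.ediam S ^ (s : ℝ)) 0 with h0 | h0
    · rw [h0, ENNReal.inv_zero] at hle
      by_contra! hpos
      rw [h0, mul_zero] at hpos
      rw [ENNReal.top_mul hpos.ne'] at hle
      exact (ENNReal.natCast_ne_top n) (top_le_iff.1 hle)
    · rw [mul_comm (n : ℝ≥0∞)]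
      exact (ENNReal.inv_mul_le_iff h0 hdtop).1 hle
  -- Dividing by `n + 1` rather than `n` covers the case `n = 0`.
  let ν : Measure Y := ((n : ℝ≥0∞) + 1)⁻¹ • (μ.restrict A).map T
  have hn0 : ((n : ℝ≥0∞) + 1) ≠ 0 := by simp
  have hntop : ((n : ℝ≥0∞) + 1) ≠ ∞ := by simp
  have hν : ν ≤ μH[(s : ℝ)] := by
    refine Measure.le_hausdorffMeasure s ν 1 one_pos fun S hS => ?_
    refine (measure_mono subset_closure).trans ?_
    rw [← Metric.ediam_closure S] at hS ⊢
    simp only [ν, Measure.smul_apply, smul_eq_mul]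
    rw [Measure.map_apply hTm measurableSet_closure,
      Measure.restrict_apply (hTm measurableSet_closure), ENNReal.inv_mul_le_iff hn0 hntop]
    refine (hball _ hS measurableSet_closure).trans ?_
    gcongr
    exact le_self_add
  refine le_dimH_of_hausdorffMeasure_ne_zero fun h0 => hn ?_
  have h1 : ν (T '' K) = 0 := le_antisymm ((hν _).trans h0.le) zero_le
  have hKm := (hK.image hT).measurableSet
  simp only [ν, Measure.smul_apply, smul_eq_mul, mul_eq_zero, ENNReal.inv_eq_zero, hntop,
    false_or] at h1
  rw [Measure.map_apply hTm hKm, Measure.restrict_apply (hTm hKm)] at h1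
  refine le_antisymm ((measure_mono (t := (T ⁻¹' (T '' K) ∩ A) ∪ Kᶜ) fun x hx => ?_).trans
    ((measure_union_le _ _).trans (by rw [h1, hμK, add_zero]))) zero_le
  by_cases hxK : x ∈ K
  · exact .inl ⟨mem_image_of_mem T hxK, hx⟩
  · exact .inr hxK

/-! ### Kaufman's argument for transversal families of linear maps. -/

section Projections

variable {Θ : Type*} [MeasurableSpace Θ] {ι : Type*} [Fintype ι]
  {E : Type*} [NormedAddCommGroup E] [NormedSpace ℝ E]
  {F : Type*} [NormedAddCommGroup F] [NormedSpace ℝ F]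

/-- Homogeneity reduces to unit vectors. At `z = 0` the right-hand side is `C * ∞`, which is why `C
≠ 0` is required. -/
theorem lintegral_inv_rpow_enorm_apply_le {lam : Measure Θ} {T : Θ → E →L[ℝ] F} {s : ℝ}
    (hs : 0 < s) {C : ℝ≥0∞} (hC : C ≠ 0)
    (h : ∀ e, ‖e‖ = 1 → ∫⁻ θ, (‖T θ e‖ₑ ^ s)⁻¹ ∂lam ≤ C) (z : E) :
    ∫⁻ θ, (‖T θ z‖ₑ ^ s)⁻¹ ∂lam ≤ C * (‖z‖ₑ ^ s)⁻¹ := by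
  rcases eq_or_ne z 0 with rfl | hz
  · simp [hs, ENNReal.mul_top hC]
  have hz' : ‖z‖ ≠ 0 := norm_ne_zero_iff.2 hz
  have hTz : ∀ θ, (‖T θ z‖ₑ ^ s)⁻¹ = (‖z‖ₑ ^ s)⁻¹ * (‖T θ (‖z‖⁻¹ • z)‖ₑ ^ s)⁻¹ := by
    intro θ
    have : T θ z = ‖z‖ • T θ (‖z‖⁻¹ • z) := by
      rw [map_smul, smul_smul, mul_inv_cancel₀ hz', one_smul]
    have h0 : ‖z‖ₑ ^ s ≠ 0 := by simp [ENNReal.rpow_eq_zero_iff, hz, hs.not_gt]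
    have htop : ‖z‖ₑ ^ s ≠ ∞ := ENNReal.rpow_ne_top_of_nonneg hs.le (by simp)
    conv_lhs => rw [this]
    rw [enorm_smul, enorm_norm, ENNReal.mul_rpow_of_nonneg _ _ hs.le,
      ENNReal.mul_inv (.inl h0) (.inl htop)]
  simp only [hTz]
  rw [lintegral_const_mul' _ _ (ENNReal.inv_ne_top.2
    (by simp [ENNReal.rpow_eq_zero_iff, hz, hs.not_gt])), mul_comm]
  gcongr
  exact h _ (by rw [norm_smul, norm_inv, norm_norm, inv_mul_cancel₀ hz'])

variable [MeasurableSpace F] [BorelSpace F]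

theorem ae_energy_ne_top [SecondCountableTopology E] [MeasurableSpace E] [BorelSpace E]
    {lam : Measure Θ} [SFinite lam] {μ : Measure E} [IsFiniteMeasure μ]
    {T : Θ → E →L[ℝ] F} (hT : Measurable T) {s : ℝ} (hs : 0 < s) {D₁ D₂ : ℝ≥0∞} (hD₁ : D₁ ≠ ∞)
    (hD₂ : D₂ ≠ ∞) (hpot : ∀ x, ∫⁻ y, (edist x y ^ s)⁻¹ ∂μ ≤ D₁)
    (hpar : ∀ e, ‖e‖ = 1 → ∫⁻ θ, (‖T θ e‖ₑ ^ s)⁻¹ ∂lam ≤ D₂) :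
    ∀ᵐ θ ∂lam, ∫⁻ x, ∫⁻ y, (edist (T θ x) (T θ y) ^ s)⁻¹ ∂μ ∂μ ≠ ∞ := by
  let g : Θ → E × E → ℝ≥0∞ := fun θ z => (‖T θ (z.1 - z.2)‖ₑ ^ s)⁻¹
  have hpar' := lintegral_inv_rpow_enorm_apply_le hs (C := 1 + D₂) (by simp)
    fun e he => (hpar e he).trans le_add_self
  have hg : Measurable (Function.uncurry g) := by
    refine (Measurable.pow_const (Measurable.enorm ?_) _).inv
    exact ContinuousLinearMap.measurable_apply₂.comp ((hT.comp measurable_fst).prodMk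
      ((measurable_fst.comp measurable_snd).sub (measurable_snd.comp measurable_snd)))
  let d : E × E → ℝ≥0∞ := fun z => (edist z.1 z.2 ^ s)⁻¹
  have hd : Measurable d := (measurable_edist.pow_const s).inv
  have henergy : ∫⁻ θ, ∫⁻ z, g θ z ∂(μ.prod μ) ∂lam ≠ ∞ := by
    refine ne_top_of_le_ne_top (ENNReal.mul_ne_top (ENNReal.add_ne_top.2
      ⟨ENNReal.one_ne_top, hD₂⟩) (ENNReal.mul_ne_top hD₁ (measure_ne_top μ univ))) ?_
    calc ∫⁻ θ, ∫⁻ z, g θ z ∂(μ.prod μ) ∂lam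
        = ∫⁻ z, ∫⁻ θ, g θ z ∂lam ∂(μ.prod μ) := lintegral_lintegral_swap hg.aemeasurable
      _ ≤ ∫⁻ z, (1 + D₂) * d z ∂(μ.prod μ) := by
          refine lintegral_mono fun z => ?_
          simp only [d, edist_eq_enorm_sub]
          exact hpar' _
      _ = (1 + D₂) * ∫⁻ x, ∫⁻ y, d (x, y) ∂μ ∂μ := by
          rw [lintegral_const_mul _ hd, lintegral_prod _ hd.aemeasurable]
      _ ≤ (1 + D₂) * ∫⁻ _, D₁ ∂μ := mul_le_mul_right (lintegral_mono hpot) _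
      _ = _ := by rw [lintegral_const]
  filter_upwards [ae_lt_top hg.lintegral_prod_right henergy] with θ hθ
  rw [lintegral_prod (g θ) (hg.comp measurable_prodMk_left).aemeasurable] at hθ
  simpa only [edist_eq_enorm_sub, ← map_sub] using hθ.ne

variable [SecondCountableTopology F]

/-- A family of linear maps which is transversal of order `p` preserves, for almost every
parameter, the lower bounds on the Hausdorff dimension of analytic sets of dimension at most
`p`. -/
theorem MeasureTheory.AnalyticSet.ae_dimH_le_dimH_image {lam : Measure Θ} [IsFiniteMeasure lam]
    {T : Θ → EuclideanSpace ℝ ι →L[ℝ] F} (hT : Measurable T) {p : ℝ≥0} {C : ℝ≥0∞} (hC : C ≠ ∞)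
    (htrans : ∀ e, ‖e‖ = 1 → ∀ k : ℕ,
      lam {θ | ‖T θ e‖ₑ < 2⁻¹ ^ k} ≤ C * (2⁻¹ ^ k) ^ (p : ℝ))
    {B : Set (EuclideanSpace ℝ ι)} (hB : AnalyticSet B) (hBp : dimH B ≤ p) :
    ∀ᵐ θ ∂lam, dimH B ≤ dimH (T θ '' B) := by
  have key : ∀ s : ℝ≥0, (s : ℝ≥0∞) < dimH B → ∀ᵐ θ ∂lam, s ≤ dimH (T θ '' B) := by
    intro s hs
    rcases eq_or_ne s 0 with rfl | hs0
    · simp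
    have hs0' : (0 : ℝ) < s := NNReal.coe_pos.2 (pos_iff_ne_zero.2 hs0)
    obtain ⟨t, hst, htB⟩ := ENNReal.lt_iff_exists_nnreal_btwn.1 hs
    have hst' : (s : ℝ) < t := by exact_mod_cast hst
    have hsp' : (s : ℝ) < p := by exact_mod_cast hs.trans_le hBp
    obtain ⟨K, hKB, hK, μ, hμ, hμK, C₁, hC₁, hball⟩ := hB.exists_frostman_measure
      (hs0'.trans hst') (by rw [hausdorffMeasure_of_lt_dimH htB]; simp)
    have hTm : ∀ e, Measurable fun θ => ‖T θ e‖ₑ := fun e =>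
      (hT.apply_continuousLinearMap e).enorm
    have hpot := fun x => lintegral_inv_rpow_le (μ := μ) (h := fun y => edist x y)
      (by fun_prop) hs0'.le (hball x)
    set D₁ := μ univ + C₁ * ((2⁻¹ ^ (s : ℝ))⁻¹ * (1 - 2⁻¹ ^ ((t : ℝ) - s))⁻¹) with hD₁def
    have hD₁ : D₁ ≠ ∞ := ENNReal.add_ne_top.2 ⟨measure_ne_top _ _,
      ENNReal.mul_ne_top hC₁ (energyConstant_ne_top hs0'.le hst')⟩
    have hpar := fun e he => lintegral_inv_rpow_le (hTm e) hs0'.le (htrans e he)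
    set D₂ := lam univ + C * ((2⁻¹ ^ (s : ℝ))⁻¹ * (1 - 2⁻¹ ^ ((p : ℝ) - s))⁻¹) with hD₂def
    have hD₂ : D₂ ≠ ∞ := ENNReal.add_ne_top.2 ⟨measure_ne_top _ _,
      ENNReal.mul_ne_top hC (energyConstant_ne_top hs0'.le hsp')⟩
    filter_upwards [ae_energy_ne_top hT hs0' hD₁ hD₂ hpot hpar] with θ hθ
    exact (le_dimH_image_of_energy_ne_top (IsProbabilityMeasure.ne_zero μ) hK hμK
      (T θ).continuous (pos_iff_ne_zero.2 hs0) hθ).trans (dimH_mono (image_mono hKB))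
  -- The exceptional null set depends on `s`; restricting to rational exponents leaves countably
  -- many of them.
  have hall : ∀ᵐ θ ∂lam, ∀ r : ℚ, ((Real.toNNReal r : ℝ≥0) : ℝ≥0∞) < dimH B →
      ((Real.toNNReal r : ℝ≥0) : ℝ≥0∞) ≤ dimH (T θ '' B) := by
    rw [ae_all_iff]
    intro r
    by_cases hr : ((Real.toNNReal r : ℝ≥0) : ℝ≥0∞) < dimH B
    · filter_upwards [key _ hr] with θ hθ _ using hθ
    · exact Eventually.of_forall fun θ h => absurd h hr
  filter_upwards [hall] with θ hθ
  refine le_of_forall_lt fun a ha => ?_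
  obtain ⟨r, _, har, hrB⟩ := ENNReal.lt_iff_exists_rat_btwn.1 ha
  exact har.trans_le (hθ r hrB)

theorem ofReal_inv_two_pow_rpow (k : ℕ) {p : ℝ} :
    ENNReal.ofReal ((2⁻¹ ^ k : ℝ) ^ p) = (2⁻¹ ^ k : ℝ≥0∞) ^ p := by
  rw [← ENNReal.ofReal_rpow_of_pos (by positivity), ENNReal.ofReal_pow (by norm_num),
    ENNReal.ofReal_inv_of_pos (by norm_num), ENNReal.ofReal_ofNat]

theorem MeasureTheory.AnalyticSet.ae_restrict_dimH_le_dimH_image {I : Set ℝ}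
    (hI : MeasurableSet I) (hIfin : volume I ≠ ∞)
    {T : ℝ → EuclideanSpace ℝ ι →L[ℝ] F} (hT : ContinuousOn T I) {p : ℝ≥0} {C : ℝ}
    (htrans : ∀ e, ‖e‖ = 1 → ∀ δ : ℝ, 0 < δ → δ ≤ 1 →
      volume {θ | θ ∈ I ∧ ‖T θ e‖ < δ} ≤ ENNReal.ofReal (C * δ ^ (p : ℝ)))
    {B : Set (EuclideanSpace ℝ ι)} (hB : AnalyticSet B) (hBp : dimH B ≤ p) :
    ∀ᵐ θ ∂(volume.restrict I), dimH B ≤ dimH (T θ '' B) := by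
  classical
  have : IsFiniteMeasure (volume.restrict I) := ⟨by simpa [lt_top_iff_ne_top] using hIfin⟩
  have hTm : Measurable (I.piecewise T 0) := hT.measurable_piecewise continuousOn_const hI
  have h := hB.ae_dimH_le_dimH_image (lam := volume.restrict I) hTm (p := p)
    (C := ENNReal.ofReal C) ENNReal.ofReal_ne_top (fun e he k => ?_) hBp
  · filter_upwards [h, ae_restrict_mem hI] with θ hθ hθI
    rwa [piecewise_eq_of_mem _ _ _ hθI] at hθ
  · rw [Measure.restrict_apply' hI]
    have hk : (2⁻¹ ^ k : ℝ≥0∞) = ENNReal.ofReal (2⁻¹ ^ k : ℝ) := by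
      simpa using (ofReal_inv_two_pow_rpow k (p := 1)).symm
    rw [← ofReal_inv_two_pow_rpow, ← ENNReal.ofReal_mul' (by positivity)]
    refine (measure_mono fun θ hθ => ?_).trans
      (htrans e he (2⁻¹ ^ k) (by positivity) (pow_le_one₀ (by norm_num) (by norm_num)))
    obtain ⟨hθ, hθI⟩ := hθ
    refine ⟨hθI, ?_⟩
    change ‖I.piecewise T 0 θ e‖ₑ < _ at hθ
    rw [piecewise_eq_of_mem _ _ _ hθI, hk, ← ofReal_norm,
      ENNReal.ofReal_lt_ofReal_iff (by positivity)] at hθ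
    exact hθ

end Projections

/-! ### Localisation and sublevel sets of functions of one variable. -/

theorem ae_restrict_of_forall_exists_ball {U : Set ℝ} (hU : IsOpen U) {P : ℝ → Prop}
    (h : ∀ θ₀ ∈ U, ∃ r > 0, ∀ᵐ θ ∂(volume.restrict (Metric.ball θ₀ r)), P θ) :
    ∀ᵐ θ ∂(volume.restrict U), P θ := by
  rw [ae_restrict_iff' hU.measurableSet, ae_iff]
  refine measure_null_of_locally_null _ fun θ₀ hθ₀ => ?_
  have hθ₀U : θ₀ ∈ U := by
    by_contra hn
    exact hθ₀ fun h => absurd h hn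
  obtain ⟨r, hr, hP⟩ := h θ₀ hθ₀U
  rw [ae_restrict_iff' measurableSet_ball, ae_iff] at hP
  refine ⟨_, inter_mem_nhdsWithin _ (Metric.ball_mem_nhds θ₀ hr), measure_mono_null ?_ hP⟩
  rintro θ ⟨hθ, hθr⟩ hn
  exact hθ fun _ => hn hθr

theorem volume_le_ofReal_of_forall_sub_le {S : Set ℝ} {d : ℝ}
    (h : ∀ x ∈ S, ∀ y ∈ S, x ≤ y → y - x ≤ d) : volume S ≤ ENNReal.ofReal d := by
  refine (Real.volume_le_diam S).trans (Metric.ediam_le fun x hx y hy => ?_)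
  rw [edist_dist, Real.dist_eq]
  refine ENNReal.ofReal_le_ofReal ?_
  rcases le_total x y with hxy | hxy
  · rw [abs_sub_comm, abs_of_nonneg (sub_nonneg.2 hxy)]
    exact h x hx y hy hxy
  · rw [abs_of_nonneg (sub_nonneg.2 hxy)]
    exact h y hy x hx hxy

theorem mul_sub_le_sub_of_le_hasDerivAt {I : Set ℝ} (hI : Convex ℝ I) {g g' : ℝ → ℝ} {c : ℝ}
    (hg : ∀ x ∈ I, HasDerivAt g (g' x) x) (hc : ∀ x ∈ I, c ≤ g' x) :
    ∀ x ∈ I, ∀ y ∈ I, x ≤ y → c * (y - x) ≤ g y - g x :=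
  hI.mul_sub_le_image_sub_of_le_deriv (fun x hx => (hg x hx).continuousAt.continuousWithinAt)
    (fun x hx => (hg x (interior_subset hx)).differentiableAt.differentiableWithinAt)
    fun x hx => (hg x (interior_subset hx)).deriv ▸ hc x (interior_subset hx)

theorem volume_abs_lt_le_of_le_deriv {I : Set ℝ} (hI : Convex ℝ I) {g g' : ℝ → ℝ} {c δ : ℝ}
    (hc : 0 < c) (hg : ∀ x ∈ I, HasDerivAt g (g' x) x) (hgc : ∀ x ∈ I, c ≤ g' x) :
    volume {x | x ∈ I ∧ |g x| < δ} ≤ ENNReal.ofReal (2 * δ / c) := by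
  refine volume_le_ofReal_of_forall_sub_le fun x hx y hy hxy => ?_
  have h := mul_sub_le_sub_of_le_hasDerivAt hI hg hgc x hx.1 y hy.1 hxy
  rw [le_div_iff₀ hc]
  have h1 := (abs_lt.1 hx.2).1
  have h2 := (abs_lt.1 hy.2).2
  linarith

/-- Split according to `g' < -(c * d)`, `g' > c * d` and `|g'| ≤ c * d`, where `c * d ^ 2 = δ`. As
`g'` is increasing, a lower bound for `|g'|` at the appropriate endpoint persists on the whole
interval between two points of either outer piece, and `g` varies there by less than `2 * δ`. On the
middle piece `g'` varies by at most `2 * c * d`. Each piece thus has diameter at most `2 * d`. -/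
theorem volume_abs_lt_le_of_le_deriv_deriv {I : Set ℝ} (hI : Convex ℝ I) {g g' g'' : ℝ → ℝ}
    {c δ : ℝ} (hc : 0 < c) (hδ : 0 < δ) (hg : ∀ x ∈ I, HasDerivAt g (g' x) x)
    (hg' : ∀ x ∈ I, HasDerivAt g' (g'' x) x) (hgc : ∀ x ∈ I, c ≤ g'' x) :
    volume {x | x ∈ I ∧ |g x| < δ} ≤ ENNReal.ofReal (6 * √(δ / c)) := by
  set d := √(δ / c) with hd
  have hd0 : 0 < d := Real.sqrt_pos.2 (div_pos hδ hc)
  have hdd : c * d * d = δ := by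
    rw [mul_assoc, Real.mul_self_sqrt (div_pos hδ hc).le]
    field_simp
  have hmono := mul_sub_le_sub_of_le_hasDerivAt hI hg' hgc
  have hsub : ∀ x ∈ I, ∀ y ∈ I, ∀ z ∈ Icc x y, z ∈ I := fun x hx y hy z hz =>
    hI.ordConnected.out hx hy hz
  have hS : {x | x ∈ I ∧ |g x| < δ} ⊆
      {x | (x ∈ I ∧ |g x| < δ) ∧ g' x < -(c * d)} ∪ ({x | (x ∈ I ∧ |g x| < δ) ∧ c * d < g' x} ∪
        {x | (x ∈ I ∧ |g x| < δ) ∧ |g' x| ≤ c * d}) := by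
    intro x hx
    rcases lt_or_ge (g' x) (-(c * d)) with h | h
    · exact .inl ⟨hx, h⟩
    rcases lt_or_ge (c * d) (g' x) with h' | h'
    · exact .inr (.inl ⟨hx, h'⟩)
    · exact .inr (.inr ⟨hx, abs_le.2 ⟨h, h'⟩⟩)
  have hcd : 0 < c * d := mul_pos hc hd0
  have h1 : volume {x | (x ∈ I ∧ |g x| < δ) ∧ g' x < -(c * d)} ≤ ENNReal.ofReal (2 * d) := by
    refine volume_le_ofReal_of_forall_sub_le fun x hx y hy hxy => ?_
    have h := mul_sub_le_sub_of_le_hasDerivAt (convex_Icc x y) (g := fun z => -g z)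
      (g' := fun z => -g' z) (c := c * d)
      (fun z hz => (hg z (hsub x hx.1.1 y hy.1.1 z hz)).neg)
      (fun z hz => by
        have hz' := hmono z (hsub x hx.1.1 y hy.1.1 z hz) y hy.1.1 hz.2
        have : 0 ≤ c * (y - z) := mul_nonneg hc.le (sub_nonneg.2 hz.2)
        have := hy.2
        linarith) x (left_mem_Icc.2 hxy) y (right_mem_Icc.2 hxy) hxy
    have h2 := (abs_lt.1 hx.1.2).2
    have h3 := (abs_lt.1 hy.1.2).1
    refine le_of_mul_le_mul_left ?_ hcd
    linarith
  have h2 : volume {x | (x ∈ I ∧ |g x| < δ) ∧ c * d < g' x} ≤ ENNReal.ofReal (2 * d) := by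
    refine volume_le_ofReal_of_forall_sub_le fun x hx y hy hxy => ?_
    have h := mul_sub_le_sub_of_le_hasDerivAt (convex_Icc x y) (g := g) (g' := g') (c := c * d)
      (fun z hz => hg z (hsub x hx.1.1 y hy.1.1 z hz))
      (fun z hz => by
        have hz' := hmono x hx.1.1 z (hsub x hx.1.1 y hy.1.1 z hz) hz.1
        have : 0 ≤ c * (z - x) := mul_nonneg hc.le (sub_nonneg.2 hz.1)
        have := hx.2
        linarith) x (left_mem_Icc.2 hxy) y (right_mem_Icc.2 hxy) hxy
    have h2 := (abs_lt.1 hx.1.2).1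
    have h3 := (abs_lt.1 hy.1.2).2
    refine le_of_mul_le_mul_left ?_ hcd
    linarith
  have h3 : volume {x | (x ∈ I ∧ |g x| < δ) ∧ |g' x| ≤ c * d} ≤ ENNReal.ofReal (2 * d) := by
    refine volume_le_ofReal_of_forall_sub_le fun x hx y hy hxy => ?_
    have h := hmono x hx.1.1 y hy.1.1 hxy
    have h2 := (abs_le.1 hx.2).1
    have h3 := (abs_le.1 hy.2).2
    refine le_of_mul_le_mul_left ?_ hc
    linarith
  refine (measure_mono hS).trans ((measure_union_le _ _).trans ((add_le_add h1
    ((measure_union_le _ _).trans (add_le_add h2 h3))).trans (le_of_eq ?_)))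
  rw [← ENNReal.ofReal_add (by positivity) (by positivity),
    ← ENNReal.ofReal_add (by positivity) (by positivity)]
  congr 1
  ring

/-- The sum of the three absolute values is continuous on the compact unit sphere and has no zero
there, since a zero would be orthogonal to the whole space. One summand is at least a third of the
minimum. -/
theorem exists_pos_le_abs_inner_of_span_eq_top {E : Type*} [NormedAddCommGroup E]
    [InnerProductSpace ℝ E] [FiniteDimensional ℝ E] {v₀ v₁ v₂ : E}
    (h : Submodule.span ℝ {v₀, v₁, v₂} = ⊤) :
    ∃ c > 0, ∀ e : E, ‖e‖ = 1 →
      c ≤ |inner ℝ v₀ e| ∨ c ≤ |inner ℝ v₁ e| ∨ c ≤ |inner ℝ v₂ e| := by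
  rcases (Metric.sphere (0 : E) 1).eq_empty_or_nonempty with hS | hS
  · refine ⟨1, one_pos, fun e he => ?_⟩
    have : e ∈ Metric.sphere (0 : E) 1 := by simpa using he
    simp [hS] at this
  obtain ⟨e₀, he₀, hmin⟩ := (isCompact_sphere (0 : E) 1).exists_isMinOn hS
    (f := fun e : E => |inner ℝ v₀ e| + |inner ℝ v₁ e| + |inner ℝ v₂ e|)
    (Continuous.continuousOn (by fun_prop))
  set m := |inner ℝ v₀ e₀| + |inner ℝ v₁ e₀| + |inner ℝ v₂ e₀| with hm
  have hm0 : 0 < m := by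
    refine lt_of_le_of_ne (by positivity) fun hm0 => ?_
    have a0 := abs_nonneg (inner ℝ v₀ e₀)
    have a1 := abs_nonneg (inner ℝ v₁ e₀)
    have a2 := abs_nonneg (inner ℝ v₂ e₀)
    have b0 : inner ℝ v₀ e₀ = 0 := abs_eq_zero.1 (by linarith)
    have b1 : inner ℝ v₁ e₀ = 0 := abs_eq_zero.1 (by linarith)
    have b2 : inner ℝ v₂ e₀ = 0 := abs_eq_zero.1 (by linarith)
    have hle : Submodule.span ℝ {v₀, v₁, v₂} ≤ (ℝ ∙ e₀)ᗮ := by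
      rw [Submodule.span_le]
      rintro x (rfl | rfl | rfl) <;>
        rw [SetLike.mem_coe, Submodule.mem_orthogonal_singleton_iff_inner_left] <;> assumption
    have he : e₀ ∈ (ℝ ∙ e₀)ᗮ := hle (h ▸ Submodule.mem_top)
    rw [Submodule.mem_orthogonal_singleton_iff_inner_left, inner_self_eq_zero] at he
    simp [he] at he₀
  refine ⟨m / 3, by positivity, fun e he => ?_⟩
  have hme : m ≤ |inner ℝ v₀ e| + |inner ℝ v₁ e| + |inner ℝ v₂ e| :=
    hmin (by simpa using he : e ∈ Metric.sphere (0 : E) 1)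
  by_contra! hcon
  linarith [hcon.1, hcon.2.1, hcon.2.2]

/-! ### Projection along a unit vector. -/

section InnerProduct

variable {E : Type*} [NormedAddCommGroup E] [InnerProductSpace ℝ E]

theorem abs_inner_sub_inner_le {v w e : E} (he : ‖e‖ = 1) :
    |inner ℝ v e - inner ℝ w e| ≤ ‖v - w‖ := by
  rw [← inner_sub_left]
  simpa [he] using abs_real_inner_le_norm (v - w) e

theorem HasDerivAt.inner_const_right {f : ℝ → E} {f' e : E} {θ : ℝ} (h : HasDerivAt f f' θ) :
    HasDerivAt (fun θ => Inner.inner ℝ (f θ) e) (Inner.inner ℝ f' e) θ := by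
  simpa using h.inner ℝ (hasDerivAt_const θ e)

theorem norm_sub_le_or_norm_add_le {u e : E} (hu : ‖u‖ = 1)
    (he : ‖e‖ = 1) {δ : ℝ} (h : ‖e - inner ℝ u e • u‖ < δ) :
    ‖u - e‖ ≤ 2 * δ ∨ ‖u + e‖ ≤ 2 * δ := by
  set a := inner ℝ u e with ha
  have h1 : |1 - abs a| < δ := by
    have := abs_norm_sub_norm_le e (a • u)
    rw [he, norm_smul, hu, mul_one, Real.norm_eq_abs] at this
    exact this.trans_lt h
  rcases le_total 0 a with h0 | h0
  · left
    rw [abs_of_nonneg h0] at h1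
    have : u - e = (1 - a) • u - (e - a • u) := by rw [sub_smul, one_smul]; abel
    rw [this]
    refine (norm_sub_le _ _).trans ?_
    rw [norm_smul, hu, mul_one, Real.norm_eq_abs]
    linarith
  · right
    rw [abs_of_nonpos h0, sub_neg_eq_add] at h1
    have : u + e = (1 + a) • u + (e - a • u) := by rw [add_smul, one_smul]; abel
    rw [this]
    refine (norm_add_le _ _).trans ?_
    rw [norm_smul, hu, mul_one, Real.norm_eq_abs]
    linarith

/-- The continuous linear map `x ↦ x - ⟪u, x⟫ u`; for a unit vector `u` this is the orthogonal
projection onto the orthogonal complement of `u`. -/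
noncomputable def rejection (u : E) : E →L[ℝ] E :=
  ContinuousLinearMap.id ℝ E - ContinuousLinearMap.smulRightL ℝ E E (innerSL ℝ u) u

theorem rejection_apply (u x : E) : rejection u x = x - inner ℝ u x • u := by
  simp [rejection]

theorem continuous_rejection : Continuous (rejection : E → E →L[ℝ] E) :=
  continuous_const.sub (((ContinuousLinearMap.smulRightL ℝ E E).continuous.comp
    (innerSL ℝ).continuous).clm_apply continuous_id)

end InnerProduct

/-! ### Transversality of the two families of projections. -/

namespace IsNonDegenerateCurve

variable {U : Set ℝ} {γ : ℝ → EuclideanSpace ℝ (Fin 3)}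

theorem contDiffOn_deriv (hγ : IsNonDegenerateCurve U γ) : ContDiffOn ℝ 2 (deriv γ) U :=
  hγ.contDiffOn.deriv_of_isOpen hγ.isOpen (by norm_num)

theorem hasDerivAt (hγ : IsNonDegenerateCurve U γ) {θ : ℝ} (hθ : θ ∈ U) :
    HasDerivAt γ (deriv γ θ) θ :=
  ((hγ.contDiffOn.differentiableOn (by norm_num)).differentiableAt
    (hγ.isOpen.mem_nhds hθ)).hasDerivAt

theorem hasDerivAt_deriv (hγ : IsNonDegenerateCurve U γ) {θ : ℝ} (hθ : θ ∈ U) :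
    HasDerivAt (deriv γ) (deriv (deriv γ) θ) θ :=
  ((hγ.contDiffOn_deriv.differentiableOn (by norm_num)).differentiableAt
    (hγ.isOpen.mem_nhds hθ)).hasDerivAt

theorem continuousOn (hγ : IsNonDegenerateCurve U γ) : ContinuousOn γ U :=
  hγ.contDiffOn.continuousOn

theorem continuousOn_deriv_deriv (hγ : IsNonDegenerateCurve U γ) :
    ContinuousOn (deriv (deriv γ)) U :=
  (hγ.contDiffOn_deriv.deriv_of_isOpen (m := 1) hγ.isOpen (by norm_num)).continuousOn

theorem deriv_ne_zero (hγ : IsNonDegenerateCurve U γ) {θ : ℝ} (hθ : θ ∈ U) : deriv γ θ ≠ 0 := by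
  intro h0
  have h := hγ.span_eq_top θ hθ
  have h1 : Submodule.span ℝ {γ θ, deriv γ θ, deriv (deriv γ) θ} ≤
      Submodule.span ℝ (({γ θ, deriv (deriv γ) θ} : Finset _) :
        Set (EuclideanSpace ℝ (Fin 3))) := by
    rw [Submodule.span_le]
    rintro x (rfl | rfl | rfl)
    · exact Submodule.subset_span (by simp)
    · rw [h0]; exact Submodule.zero_mem _
    · exact Submodule.subset_span (by simp)
  rw [h, top_le_iff] at h1
  have h2 := finrank_span_finset_le_card (R := ℝ)
    ({γ θ, deriv (deriv γ) θ} : Finset (EuclideanSpace ℝ (Fin 3)))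
  rw [Set.finrank, h1, finrank_top, finrank_euclideanSpace_fin] at h2
  have := h2.trans Finset.card_le_two
  omega

theorem exists_ball (hγ : IsNonDegenerateCurve U γ) {θ₀ : ℝ} (hθ₀ : θ₀ ∈ U) {ε : ℝ}
    (hε : 0 < ε) :
    ∃ r > 0, Metric.ball θ₀ r ⊆ U ∧ ∀ θ ∈ Metric.ball θ₀ r, ‖γ θ - γ θ₀‖ ≤ ε ∧
      ‖deriv γ θ - deriv γ θ₀‖ ≤ ε ∧ ‖deriv (deriv γ) θ - deriv (deriv γ) θ₀‖ ≤ ε := by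
  have hU := hγ.isOpen.mem_nhds hθ₀
  have h : ∀ f : ℝ → EuclideanSpace ℝ (Fin 3), ContinuousOn f U →
      ∀ᶠ θ in 𝓝 θ₀, ‖f θ - f θ₀‖ ≤ ε := fun f hf => by
    filter_upwards [(hf.continuousAt hU).eventually (Metric.ball_mem_nhds _ hε)] with θ hθ
    exact (mem_ball_iff_norm.1 hθ).le
  obtain ⟨r, hr, hball⟩ := Metric.eventually_nhds_iff_ball.1
    (((h _ hγ.continuousOn).and ((h _ hγ.contDiffOn_deriv.continuousOn).and
      (h _ hγ.continuousOn_deriv_deriv))).and (eventually_mem_set.2 hU))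
  exact ⟨r, hr, fun θ hθ => (hball θ hθ).2, fun θ hθ => (hball θ hθ).1⟩

theorem exists_volume_abs_inner_lt_le (hγ : IsNonDegenerateCurve U γ) {θ₀ : ℝ} (hθ₀ : θ₀ ∈ U) :
    ∃ r > 0, Metric.ball θ₀ r ⊆ U ∧ ∃ C : ℝ, ∀ e : EuclideanSpace ℝ (Fin 3), ‖e‖ = 1 →
      ∀ δ : ℝ, 0 < δ → δ ≤ 1 →
        volume {θ | θ ∈ Metric.ball θ₀ r ∧ |inner ℝ (γ θ) e| < δ} ≤ ENNReal.ofReal (C * √δ) := by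
  obtain ⟨c, hc, hcmax⟩ := exists_pos_le_abs_inner_of_span_eq_top (hγ.span_eq_top θ₀ hθ₀)
  obtain ⟨r, hr, hrU, hball⟩ := hγ.exists_ball hθ₀ (half_pos hc)
  -- One summand for each derivative that may be large. At order 0 the set is empty unless `δ > c /
  -- 2`, when the whole ball, of length `2 * r`, is affordable; at order 1 the bound `4 / c * δ` is
  -- weakened using `δ ≤ √δ`.
  refine ⟨r, hr, hrU, 2 * r * √(2 / c) + 4 / c + 6 * √(2 / c), fun e he δ hδ hδ1 => ?_⟩
  set I := Metric.ball θ₀ r with hI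
  have hIc : Convex ℝ I := convex_ball θ₀ r
  have hc2 : 0 < c / 2 := half_pos hc
  have hsδ : δ ≤ √δ := Real.le_sqrt_of_sq_le (by nlinarith)
  have hsδ0 : 0 < √δ := Real.sqrt_pos.2 hδ
  have hA : 0 ≤ 2 * r * √(2 / c) := by positivity
  have hB : 0 ≤ 4 / c := by positivity
  have hD : 0 ≤ 6 * √(2 / c) := by positivity
  have hlow : ∀ {v w e' : EuclideanSpace ℝ (Fin 3)}, ‖e'‖ = 1 → ‖v - w‖ ≤ c / 2 →
      c ≤ inner ℝ w e' → c / 2 ≤ inner ℝ v e' := by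
    intro v w e' he' hvw hw
    have := (abs_le.1 ((abs_inner_sub_inner_le (v := v) (w := w) he').trans hvw)).1
    linarith
  have hsign : ∀ w : EuclideanSpace ℝ (Fin 3), c ≤ |inner ℝ w e| →
      ∃ e' : EuclideanSpace ℝ (Fin 3), ‖e'‖ = 1 ∧ c ≤ inner ℝ w e' ∧
        ∀ v, |inner ℝ v e| = |inner ℝ v e'| := by
    intro w hw
    rcases le_abs.1 hw with h | h
    · exact ⟨e, he, h, fun _ => rfl⟩
    · exact ⟨-e, by simpa using he, by simpa using h, fun v => by simp⟩
  have hroot : √(δ / (c / 2)) = √(2 / c) * √δ := by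
    rw [← Real.sqrt_mul (by positivity)]
    congr 1
    field_simp
  rcases hcmax e he with h | h | h
  · obtain ⟨e', he', hw, habs⟩ := hsign _ h
    simp only [habs]
    rcases le_or_gt δ (c / 2) with hδc | hδc
    · have : {θ | θ ∈ I ∧ |inner ℝ (γ θ) e'| < δ} = ∅ := by
        rw [eq_empty_iff_forall_notMem]
        rintro θ ⟨hθ, hlt⟩
        have h1 := hlow he' (hball θ hθ).1 hw
        have h2 := le_abs_self (inner ℝ (γ θ) e')
        linarith
      rw [this]
      simp
    · refine (measure_mono fun θ hθ => hθ.1).trans (b := volume I) ?_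
      rw [hI, Real.volume_ball]
      refine ENNReal.ofReal_le_ofReal ?_
      have h1 : 1 ≤ √(2 / c) * √δ := by
        rw [← hroot]
        refine Real.one_le_sqrt.2 ?_
        rw [le_div_iff₀ hc2]
        linarith
      nlinarith [mul_nonneg hB hsδ0.le, mul_nonneg hD hsδ0.le]
  · obtain ⟨e', he', hw, habs⟩ := hsign _ h
    simp only [habs]
    refine (volume_abs_lt_le_of_le_deriv hIc hc2
      (fun θ hθ => (hγ.hasDerivAt (hrU hθ)).inner_const_right)
      fun θ hθ => hlow he' (hball θ hθ).2.1 hw).trans (ENNReal.ofReal_le_ofReal ?_)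
    have h1 : 2 * δ / (c / 2) = 4 / c * δ := by field_simp; ring
    rw [h1]
    nlinarith [mul_nonneg hA hsδ0.le, mul_nonneg hD hsδ0.le, mul_le_mul_of_nonneg_left hsδ hB]
  · obtain ⟨e', he', hw, habs⟩ := hsign _ h
    simp only [habs]
    refine (volume_abs_lt_le_of_le_deriv_deriv hIc hc2 hδ
      (fun θ hθ => (hγ.hasDerivAt (hrU hθ)).inner_const_right)
      (fun θ hθ => (hγ.hasDerivAt_deriv (hrU hθ)).inner_const_right)
      fun θ hθ => hlow he' (hball θ hθ).2.2 hw).trans (ENNReal.ofReal_le_ofReal ?_)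
    rw [hroot]
    nlinarith [mul_nonneg hA hsδ0.le, mul_nonneg hB hsδ0.le]

/-- Near `θ₀` the component of `γ` in the direction of the nonzero vector `deriv γ θ₀` grows at rate
at least `‖deriv γ θ₀‖ / 2`. -/
theorem exists_mul_sub_le_norm_sub (hγ : IsNonDegenerateCurve U γ) {θ₀ : ℝ} (hθ₀ : θ₀ ∈ U) :
    ∃ r > 0, Metric.ball θ₀ r ⊆ U ∧ ∃ c > 0, ∀ x ∈ Metric.ball θ₀ r, ∀ y ∈ Metric.ball θ₀ r,
      x ≤ y → c * (y - x) ≤ ‖γ y - γ x‖ := by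
  have hv := norm_pos_iff.2 (hγ.deriv_ne_zero hθ₀)
  set v := deriv γ θ₀ with hvdef
  set e := ‖v‖⁻¹ • v with he
  have he1 : ‖e‖ = 1 := by rw [he, norm_smul, norm_inv, norm_norm, inv_mul_cancel₀ hv.ne']
  have hve : inner ℝ v e = ‖v‖ := by
    rw [he, inner_smul_right, real_inner_self_eq_norm_sq]
    field_simp
  obtain ⟨r, hr, hrU, hball⟩ := hγ.exists_ball hθ₀ (half_pos hv)
  refine ⟨r, hr, hrU, ‖v‖ / 2, half_pos hv, fun x hx y hy hxy => ?_⟩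
  refine (mul_sub_le_sub_of_le_hasDerivAt (convex_ball θ₀ r)
    (fun θ hθ => (hγ.hasDerivAt (hrU hθ)).inner_const_right)
    (fun θ hθ => ?_) x hx y hy hxy).trans
      ((le_abs_self _).trans (abs_inner_sub_inner_le (e := e) he1))
  have := (abs_le.1 ((abs_inner_sub_inner_le (e := e) he1).trans (hball θ hθ).2.1)).1
  rw [hve] at this
  linarith

theorem exists_volume_norm_sub_lt_le (hγ : IsNonDegenerateCurve U γ) {θ₀ : ℝ} (hθ₀ : θ₀ ∈ U) :
    ∃ r > 0, Metric.ball θ₀ r ⊆ U ∧ ∃ C : ℝ, ∀ e : EuclideanSpace ℝ (Fin 3), ‖e‖ = 1 →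
      ∀ δ : ℝ, 0 < δ → volume {θ | θ ∈ Metric.ball θ₀ r ∧ ‖e - inner ℝ (γ θ) e • γ θ‖ < δ} ≤
        ENNReal.ofReal (C * δ) := by
  obtain ⟨r, hr, hrU, c, hc, hsep⟩ := hγ.exists_mul_sub_le_norm_sub hθ₀
  refine ⟨r, hr, hrU, 8 / c, fun e he δ hδ => ?_⟩
  have hpart : ∀ e' : EuclideanSpace ℝ (Fin 3),
      volume {θ | θ ∈ Metric.ball θ₀ r ∧ ‖γ θ - e'‖ ≤ 2 * δ} ≤ ENNReal.ofReal (4 * δ / c) := by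
    intro e'
    refine volume_le_ofReal_of_forall_sub_le fun x hx y hy hxy => ?_
    rw [le_div_iff₀ hc, mul_comm]
    refine (hsep x hx.1 y hy.1 hxy).trans ?_
    have := norm_sub_le (γ y - e') (γ x - e')
    rw [sub_sub_sub_cancel_right] at this
    linarith [hx.2, hy.2]
  have hsub : {θ | θ ∈ Metric.ball θ₀ r ∧ ‖e - inner ℝ (γ θ) e • γ θ‖ < δ} ⊆
      {θ | θ ∈ Metric.ball θ₀ r ∧ ‖γ θ - e‖ ≤ 2 * δ} ∪
        {θ | θ ∈ Metric.ball θ₀ r ∧ ‖γ θ - -e‖ ≤ 2 * δ} := by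
    rintro θ ⟨hθ, hlt⟩
    rcases norm_sub_le_or_norm_add_le (hγ.norm_eq_one θ (hrU hθ)) he hlt with h | h
    · exact .inl ⟨hθ, h⟩
    · exact .inr ⟨hθ, by rwa [sub_neg_eq_add]⟩
  refine (measure_mono hsub).trans ((measure_union_le _ _).trans
    ((add_le_add (hpart e) (hpart (-e))).trans (le_of_eq ?_)))
  rw [← ENNReal.ofReal_add (by positivity) (by positivity)]
  congr 1
  ring

theorem ae_dimH_le_dimH_lineProj_image (hγ : IsNonDegenerateCurve U γ)
    {B : Set (EuclideanSpace ℝ (Fin 3))} (hB : AnalyticSet B) (h : dimH B ≤ 1 / 2) :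
    ∀ᵐ θ ∂(volume.restrict U), dimH B ≤ dimH (lineProj γ θ '' B) := by
  refine ae_restrict_of_forall_exists_ball hγ.isOpen fun θ₀ hθ₀ => ?_
  obtain ⟨r, hr, hrU, C, hC⟩ := hγ.exists_volume_abs_inner_lt_le hθ₀
  refine ⟨r, hr, ?_⟩
  refine hB.ae_restrict_dimH_le_dimH_image (T := fun θ => innerSL ℝ (γ θ)) (p := 1 / 2) (C := C)
    measurableSet_ball measure_ball_lt_top.ne ?_ ?_ ?_
  · exact (innerSL ℝ).continuous.comp_continuousOn (hγ.continuousOn.mono hrU)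
  · intro e he δ hδ hδ1
    have := hC e he δ hδ hδ1
    rw [Real.sqrt_eq_rpow] at this
    simpa using this
  · simpa using h

theorem ae_dimH_le_dimH_planeProj_image (hγ : IsNonDegenerateCurve U γ)
    {B : Set (EuclideanSpace ℝ (Fin 3))} (hB : AnalyticSet B) (h : dimH B ≤ 1) :
    ∀ᵐ θ ∂(volume.restrict U), dimH B ≤ dimH (planeProj γ θ '' B) := by
  refine ae_restrict_of_forall_exists_ball hγ.isOpen fun θ₀ hθ₀ => ?_
  obtain ⟨r, hr, hrU, C, hC⟩ := hγ.exists_volume_norm_sub_lt_le hθ₀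
  refine ⟨r, hr, ?_⟩
  have key := hB.ae_restrict_dimH_le_dimH_image (p := 1) (C := C)
    (T := fun θ => rejection (γ θ))
    (measurableSet_ball (x := θ₀) (ε := r)) measure_ball_lt_top.ne ?_ ?_ (by simpa using h)
  · filter_upwards [key, ae_restrict_mem measurableSet_ball] with θ hθ hθr
    -- The target plane varies with `θ`; its isometric inclusion preserves dimension and turns the
    -- projection into `rejection`, whose target space is fixed.
    have himg : Subtype.val '' (planeProj γ θ '' B) = rejection (γ θ) '' B := by
      rw [image_image]
      refine image_congr fun x _ => ?_
      change (Submodule.span ℝ {γ θ})ᗮ.starProjection x = _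
      rw [Submodule.starProjection_orthogonal_val,
        Submodule.starProjection_unit_singleton ℝ (hγ.norm_eq_one θ (hrU hθr)), rejection_apply]
    rw [← himg] at hθ
    exact hθ.trans_eq (isometry_subtype_coe.dimH_image _)
  · exact continuous_rejection.comp_continuousOn (hγ.continuousOn.mono hrU)
  · intro e he δ hδ _
    simpa [rejection_apply] using hC e he δ hδ

end IsNonDegenerateCurve

theorem proposition1p1 (U : Set ℝ) (γ : ℝ → EuclideanSpace ℝ (Fin 3))
    (hγ : IsNonDegenerateCurve U γ)
    (B : Set (EuclideanSpace ℝ (Fin 3))) (hB : AnalyticSet B) :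
    (dimH B ≤ 1 / 2 → ∀ᵐ θ ∂(volume.restrict U), dimH (lineProj γ θ '' B) = dimH B) ∧
    (dimH B ≤ 1 → ∀ᵐ θ ∂(volume.restrict U), dimH (planeProj γ θ '' B) = dimH B) := by
  refine ⟨fun h => ?_, fun h => ?_⟩
  · filter_upwards [hγ.ae_dimH_le_dimH_lineProj_image hB h] with θ hθ
    exact le_antisymm ((innerSL ℝ (γ θ)).lipschitz.dimH_image_le B) hθ
  · filter_upwards [hγ.ae_dimH_le_dimH_planeProj_image hB h] with θ hθ
    exact le_antisymm ((orthPlane γ θ).orthogonalProjectionOnto.lipschitz.dimH_image_le B) hθ
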